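/- For $s>0$ let $H^s=H^s(\mathbb R^2)$ be the Sobolev space of (complex-valued) functions $f\in L^2(\mathbb R^2)$ with norm $\|f\|_{H^s}=\big(\int_{\mathbb R^2}(1+|\xi|^2)^s|\hat f(\xi)|^2\,d\xi\big)^{1/2}<\infty$, where $\hat f(\xi)=\int e^{-ix\cdot\xi}f(x)\,dx$. For $\theta\in L^2(\mathbb R^2)$ let $u_\theta=(-\partial_2(-\Delta)^{-1/2}\theta,\ \partial_1(-\Delta)^{-1/2}\theta)$, and let $|\partial_1|,|\partial_2|$ be the Fourier multipliers with symbols $|\xi_1|,|\xi_2|$. Let $\alpha,\beta\in(1/2,1)$, $\max\{2-2\alpha,2-2\beta\}<s<2$ and $\theta^0\in H^s$. A mild solution on $[0,T]$ with initial datum $\theta^0$ of the anisotropic quasi-geostrophic equation $$\partial_t\theta+u_\theta\cdot\nabla\theta+(|\partial_1|^{2\alpha}+|\partial_2|^{2\beta})\theta=0$$ is a function $\theta\in C([0,T],H^s)$ such that for every $t\in[0,T]$ $$\theta(t)=e^{-tA(D)}\theta^0-\int_0^t e^{-(t-\tau)A(D)}\,\mathrm{div}(\theta u_\theta)(\tau)\,d\tau,\qquad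 A(\xi)=|\xi_1|^{2\alpha}+|\xi_2|^{2\beta},$$ that is, for every $t\in[0,T]$ and almost every $\xi\in\mathbb R^2$, $$\hat\theta(t,\xi)=e^{-tA(\xi)}\hat\theta^0(\xi)-\int_0^t e^{-(t-\tau)A(\xi)}\,i\xi\cdot\widehat{\theta u_\theta}(\tau,\xi)\,d\tau .$$ Then there are $T_0>0$ and a mild solution $\theta$ on $[0,T_0]$ with $\|\theta(t)\|_{H^s}\le 2\|\theta^0\|_{H^s}$ for all $t\in[0,T_0]$. Moreover, for every $T_0>0$ and every mild solution $\theta$ on $[0,T_0]$: $\theta$ is the only mild solution on $[0,T_0]$ with initial datum $\theta^0$, and there is a time $0<T_1\le T_0$ such that $e^{t(|\partial_1|^\alpha+|\partial_2|^\beta)}\theta(t)\in H^s$ for every $t\in[0,T_1]$ and $$\big(t\mapsto e^{t(|\partial_1|^\alpha+|\partial_2|^\beta)}\theta(t)\big)\in L^\infty([0,T_1],H^s).$$ -/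

import Mathlib

open MeasureTheory Set Filter
open scoped FourierTransform ENNReal

noncomputable section

namespace AQG

/-- The plane `ℝ²` with its Euclidean structure. -/
abbrev Plane : Type := EuclideanSpace ℝ (Fin 2)

/-- The space `L²(ℝ²)` of complex valued functions. -/
abbrev L2 : Type := Lp ℂ 2 (volume : Measure Plane)

/-- The Fourier transform `ĝ(ξ) = ∫ e^{-i x·ξ} g(x) dx` of an integrable function
(Mathlib's `𝓕` has the kernel `e^{-2πi x·ξ}`; see `hatL1_eq`). -/
def hatL1 (g : Plane → ℂ) (ξ : Plane) : ℂ := 𝓕 g ((2 * Real.pi)⁻¹ • ξ)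

theorem hatL1_eq (g : Plane → ℂ) (ξ : Plane) :
    hatL1 g ξ = ∫ x, Complex.exp (-(Complex.I * (inner ℝ x ξ : ℝ))) * g x := by
  unfold hatL1
  rw [Real.fourier_eq']
  congr 1
  ext x
  rw [smul_eq_mul, real_inner_smul_right]
  congr 2
  have : (Real.pi : ℂ) ≠ 0 := by exact_mod_cast Real.pi_ne_zero
  push_cast
  field_simp

/-- The Fourier transform on `L²(ℝ²)` (Plancherel), with the same normalisation as `hatL1`;
a representative of a class modulo almost everywhere equality. -/
def hat (f : L2) (ξ : Plane) : ℂ := (𝓕 f : L2) ((2 * Real.pi)⁻¹ • ξ)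

theorem quasi_smul {c : ℝ} (hc : c ≠ 0) :
    Measure.QuasiMeasurePreserving (fun ξ : Plane => c • ξ) volume volume := by
  refine ⟨by fun_prop, ?_⟩
  rw [Measure.map_addHaar_smul volume hc]
  exact Measure.smul_absolutelyContinuous

theorem aestronglyMeasurable_hat (f : L2) : AEStronglyMeasurable (hat f) volume :=
  (Lp.aestronglyMeasurable (𝓕 f : L2)).comp_quasiMeasurePreserving
    (quasi_smul (by positivity))

theorem hat_add (f g : L2) : hat (f + g) =ᵐ[volume] hat f + hat g := by
  have h : ((𝓕 (f + g) : L2) : Plane → ℂ) =ᵐ[volume] (𝓕 f : L2) + (𝓕 g : L2) := by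
    rw [FourierTransform.fourier_add]
    exact Lp.coeFn_add _ _
  exact (quasi_smul (c := (2 * Real.pi)⁻¹) (by positivity)).ae_eq_comp h

theorem hat_neg (f : L2) : hat (-f) =ᵐ[volume] -hat f := by
  have h : ((𝓕 (-f) : L2) : Plane → ℂ) =ᵐ[volume] -(𝓕 f : L2) := by
    rw [FourierTransform.fourier_neg]
    exact Lp.coeFn_neg _
  exact (quasi_smul (c := (2 * Real.pi)⁻¹) (by positivity)).ae_eq_comp h

theorem hat_zero : hat 0 =ᵐ[volume] 0 := by
  have h : ((𝓕 (0 : L2) : L2) : Plane → ℂ) =ᵐ[volume] 0 := by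
    rw [FourierTransform.fourier_zero]
    exact Lp.coeFn_zero _ _ _
  exact (quasi_smul (c := (2 * Real.pi)⁻¹) (by positivity)).ae_eq_comp h

theorem eq_of_hat_eq {f g : L2} (h : hat f =ᵐ[volume] hat g) : f = g := by
  have h2 := (quasi_smul (c := 2 * Real.pi) (by positivity)).ae_eq_comp h
  have h3 : (𝓕 f : L2) = 𝓕 g := by
    apply Lp.ext
    filter_upwards [h2] with ξ hξ
    have hpi : (2 * Real.pi) ≠ 0 := by positivity
    simpa only [Function.comp_apply, hat, smul_smul, inv_mul_cancel₀ hpi, one_smul] using hξ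
  have := congrArg (fun k : L2 => (𝓕⁻ k : L2)) h3
  simpa using this

/-- `g = m(D) f` for the Fourier multiplier with symbol `m`: `ĝ = m f̂` almost everywhere. -/
def IsMultiplierImage (m : Plane → ℂ) (f g : L2) : Prop :=
  ∀ᵐ ξ, hat g ξ = m ξ * hat f ξ

/-! ### Sobolev spaces of nonnegative order -/

/-- `(1 + |ξ|²)^{s/2} f̂(ξ)`. -/
def weightedHat (s : ℝ) (f : L2) (ξ : Plane) : ℂ :=
  (((1 + ‖ξ‖ ^ 2) ^ (s / 2) : ℝ) : ℂ) * hat f ξ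

theorem weightedHat_add (s : ℝ) (f g : L2) :
    weightedHat s (f + g) =ᵐ[volume] weightedHat s f + weightedHat s g := by
  filter_upwards [hat_add f g] with ξ h
  simp only [weightedHat, Pi.add_apply, h, mul_add]

theorem weightedHat_neg (s : ℝ) (f : L2) :
    weightedHat s (-f) =ᵐ[volume] -weightedHat s f := by
  filter_upwards [hat_neg f] with ξ h
  simp only [weightedHat, Pi.neg_apply, h, mul_neg]

theorem weightedHat_zero (s : ℝ) : weightedHat s 0 =ᵐ[volume] 0 := by
  filter_upwards [hat_zero] with ξ h
  simp only [weightedHat, h, Pi.zero_apply, mul_zero]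

/-- The functions in `L²(ℝ²)` with `(1 + |ξ|²)^{s/2} f̂ ∈ L²(ℝ²)`. -/
def sobolevSubgroup (s : ℝ) : AddSubgroup L2 where
  carrier := {f | MemLp (weightedHat s f) 2 volume}
  add_mem' hf hg := (memLp_congr_ae (weightedHat_add s _ _)).2 (hf.add hg)
  zero_mem' := (memLp_congr_ae (weightedHat_zero s)).2 MemLp.zero
  neg_mem' hf := (memLp_congr_ae (weightedHat_neg s _)).2 hf.neg

/-- The inhomogeneous Sobolev space `H^s(ℝ²)` for `s ≥ 0` (where a tempered distribution
with `(1 + |ξ|²)^{s/2} f̂ ∈ L²` is automatically a function in `L²`). -/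
def Hs (s : ℝ) : Type := sobolevSubgroup s

instance (s : ℝ) : AddCommGroup (Hs s) :=
  inferInstanceAs (AddCommGroup (sobolevSubgroup s))

/-- The underlying square integrable function. -/
def Hs.toL2 {s : ℝ} (f : Hs s) : L2 := f.1

@[ext]
theorem Hs.ext {s : ℝ} {f g : Hs s} (h : f.toL2 = g.toL2) : f = g := Subtype.ext h

theorem Hs.toL2_add {s : ℝ} (f g : Hs s) : (f + g).toL2 = f.toL2 + g.toL2 := rfl

theorem Hs.toL2_zero {s : ℝ} : (0 : Hs s).toL2 = 0 := rfl

theorem Hs.memLp {s : ℝ} (f : Hs s) : MemLp (weightedHat s f.toL2) 2 volume := f.2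

/-- The map `f ↦ (1 + |ξ|²)^{s/2} f̂` from `H^s(ℝ²)` to `L²(ℝ²)`. -/
def toWeighted (s : ℝ) : Hs s →+ L2 where
  toFun f := MemLp.toLp (weightedHat s f.toL2) f.memLp
  map_zero' := by
    rw [← MemLp.toLp_zero (p := 2) (μ := (volume : Measure Plane)) (E := ℂ) MemLp.zero,
      MemLp.toLp_eq_toLp_iff, Hs.toL2_zero]
    exact weightedHat_zero s
  map_add' f g := by
    rw [← MemLp.toLp_add, MemLp.toLp_eq_toLp_iff, Hs.toL2_add]
    exact weightedHat_add s _ _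

theorem toWeighted_injective (s : ℝ) : Function.Injective (toWeighted s) := by
  intro f g h
  have h' : weightedHat s f.toL2 =ᵐ[volume] weightedHat s g.toL2 :=
    (MemLp.toLp_eq_toLp_iff f.memLp g.memLp).1 h
  refine Hs.ext (eq_of_hat_eq ?_)
  filter_upwards [h'] with ξ hξ
  have hpos : (0 : ℝ) < (1 + ‖ξ‖ ^ 2) ^ (s / 2) := by positivity
  exact mul_left_cancel₀ (Complex.ofReal_ne_zero.2 hpos.ne') hξ

/-- The norm `‖f‖_{H^s} = (∫ (1 + |ξ|²)^s |f̂(ξ)|² dξ)^{1/2}`; see `Hs.norm_eq`. -/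
instance (s : ℝ) : NormedAddCommGroup (Hs s) :=
  NormedAddCommGroup.induced (Hs s) L2 (toWeighted s) (toWeighted_injective s)

theorem Hs.norm_eq {s : ℝ} (f : Hs s) :
    ‖f‖ = (∫ ξ, (1 + ‖ξ‖ ^ 2) ^ s * ‖hat f.toL2 ξ‖ ^ 2) ^ (1 / 2 : ℝ) := by
  have h1 : ‖f‖ = ‖MemLp.toLp (weightedHat s f.toL2) f.memLp‖ := rfl
  rw [h1, Lp.norm_toLp, f.memLp.eLpNorm_eq_integral_rpow_norm (by norm_num) (by norm_num),
    ENNReal.toReal_ofReal (by positivity)]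
  norm_num
  congr 1
  refine integral_congr_ae (Eventually.of_forall fun ξ => ?_)
  have hpos : (0 : ℝ) < 1 + ‖ξ‖ ^ 2 := by positivity
  simp only [weightedHat, norm_mul, Complex.norm_real, mul_pow, Real.norm_eq_abs,
    sq_abs]
  rw [← Real.rpow_natCast, ← Real.rpow_mul hpos.le]
  norm_num

/-! ### The velocity and the mild formulation -/

/-- The symbols of `u¹ = -∂₂(-Δ)^{-1/2}θ` and `u² = ∂₁(-Δ)^{-1/2}θ`,
namely `-iξ₂/|ξ|` and `iξ₁/|ξ|`. -/
def velocitySymbol (j : Fin 2) (ξ : Plane) : ℂ :=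
  if j = 0 then -(Complex.I * (ξ 1 : ℂ)) / (‖ξ‖ : ℂ) else Complex.I * (ξ 0 : ℂ) / (‖ξ‖ : ℂ)

theorem norm_velocitySymbol_le (j : Fin 2) (ξ : Plane) : ‖velocitySymbol j ξ‖ ≤ 1 := by
  have h : ∀ k : Fin 2, |ξ k| / ‖ξ‖ ≤ 1 := fun k =>
    div_le_one_of_le₀ (by simpa using PiLp.norm_apply_le ξ k) (norm_nonneg _)
  unfold velocitySymbol
  split_ifs
  · simpa using h 1
  · simpa using h 0

theorem measurable_velocitySymbol (j : Fin 2) : Measurable (velocitySymbol j) := by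
  unfold velocitySymbol
  split_ifs <;> fun_prop

theorem memLp_velocitySymbol_mul (j : Fin 2) (f : L2) :
    MemLp (fun η => velocitySymbol j ((2 * Real.pi) • η) * (𝓕 f : L2) η) 2 volume := by
  refine (Lp.memLp (𝓕 f : L2)).of_le (AEStronglyMeasurable.mul ?_
    (Lp.aestronglyMeasurable _)) (Eventually.of_forall fun η => ?_)
  · exact ((measurable_velocitySymbol j).comp (by fun_prop)).aestronglyMeasurable
  · rw [norm_mul]
    exact mul_le_of_le_one_left (norm_nonneg _) (norm_velocitySymbol_le j _)

/-- The component `j` of the velocity `u_θ = 𝓡^⊥ θ`; see `velocity_spec`. -/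
def velocity (j : Fin 2) (f : L2) : L2 :=
  (𝓕⁻ (MemLp.toLp _ (memLp_velocitySymbol_mul j f)) : L2)

theorem velocity_spec (j : Fin 2) (f : L2) :
    IsMultiplierImage (velocitySymbol j) f (velocity j f) := by
  have h : ((𝓕 (velocity j f) : L2) : Plane → ℂ) =ᵐ[volume]
      fun η => velocitySymbol j ((2 * Real.pi) • η) * (𝓕 f : L2) η := by
    simp only [velocity, FourierTransform.fourier_fourierInv_eq]
    exact MemLp.coeFn_toLp _
  have h2 := (quasi_smul (c := (2 * Real.pi)⁻¹) (by positivity)).ae_eq_comp h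
  filter_upwards [h2] with ξ hξ
  have hpi : (2 * Real.pi) ≠ 0 := by positivity
  simpa only [Function.comp_apply, hat, smul_smul, mul_inv_cancel₀ hpi, one_smul] using hξ

/-- The symbol `A(ξ) = |ξ₁|^{2α} + |ξ₂|^{2β}` of the dissipation `|∂₁|^{2α} + |∂₂|^{2β}`. -/
def dissipationSymbol (α β : ℝ) (ξ : Plane) : ℝ := |ξ 0| ^ (2 * α) + |ξ 1| ^ (2 * β)

/-- The Fourier transform of `div (f u_g)`, that is `∑ⱼ i ξⱼ (f u_g^j)^(ξ)`. The product of two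
functions in `L²` is integrable, so its Fourier transform is the classical one, defined at
every `ξ`. -/
def hatDivFlux (f g : L2) (ξ : Plane) : ℂ :=
  ∑ j : Fin 2, Complex.I * (ξ j : ℂ) * hatL1 (fun x => f x * velocity j g x) ξ

/-- `θ ∈ C([0,T], H^s)` is a mild solution with initial datum `θ₀`:
`θ(t) = e^{-tA(D)} θ₀ - ∫₀ᵗ e^{-(t-τ)A(D)} div (θ u_θ)(τ) dτ` for every `t ∈ [0,T]`,
where both sides are compared through their Fourier transforms. -/
structure IsMildSolution (α β : ℝ) {s : ℝ} (θ₀ : Hs s) (T : ℝ) (θ : ℝ → Hs s) : Prop where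
  continuousOn : ContinuousOn θ (Icc 0 T)
  duhamel : ∀ t ∈ Icc 0 T, ∀ᵐ ξ : Plane,
    hat (θ t).toL2 ξ =
      (Real.exp (-(t * dissipationSymbol α β ξ)) : ℂ) * hat θ₀.toL2 ξ
      - ∫ τ in (0 : ℝ)..t, (Real.exp (-((t - τ) * dissipationSymbol α β ξ)) : ℂ) *
          hatDivFlux (θ τ).toL2 (θ τ).toL2 ξ

/-- The symbol `e^{t(|ξ₁|^α + |ξ₂|^β)}` of the operator `e^{t(|∂₁|^α + |∂₂|^β)}`. -/
def gevreySymbol (α β t : ℝ) (ξ : Plane) : ℂ :=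
  (Real.exp (t * (|ξ 0| ^ α + |ξ 1| ^ β)) : ℂ)

/-- `t ↦ e^{t(|∂₁|^α + |∂₂|^β)} θ(t)` belongs to `L^∞([0,T], H^s)`: for every `t ∈ [0,T]` it is
an element `Θ(t)` of `H^s`, and `Θ` is strongly measurable and essentially bounded. -/
def HasGevreyRegularity (α β : ℝ) {s : ℝ} (T : ℝ) (θ : ℝ → Hs s) : Prop :=
  ∃ Θ : ℝ → Hs s,
    (∀ t ∈ Icc 0 T, IsMultiplierImage (gevreySymbol α β t) (θ t).toL2 (Θ t).toL2) ∧
    MemLp Θ ∞ (volume.restrict (Icc 0 T))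

end AQG

end

/-!
The mild formulation lives on the Fourier side, and so does the argument. By density of Schwartz
functions, the Fourier transform of a product of two square integrable functions is a convolution
(`fourier_mul_eq_integral`), and the Riesz transforms have symbols bounded by one. So `div (f u_g)`
is dominated by `⟨ξ⟩` times the convolution of `|f̂|` and `|ĝ|`. The product law
`H^s · H^s ⊆ H^{s-δ}`, valid for `s + δ > 1`, shows that the flux maps `H^s × H^s` to `H^{s-δ-1}`.
Since `α, β ≤ 1`, the exponent `|ξ₁|^α + |ξ₂|^β` is subadditive, and therefore the same estimate
holds with the weight `e^{τ(|ξ₁|^α + |ξ₂|^β)}` on both sides (`lintegral_hatDivFlux_sq_le`).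

The dissipation gives the lost derivatives back. With `γ = min α β`, the symbol `A` controls `2γ`
derivatives, so that `e^{-σA}` gains `1 + δ` derivatives at the price of `σ^{-a}`, where
`a = (1 + δ) / (2γ)`. As `|ξ₁|^α + |ξ₂|^β ≤ 1 + A/2`, half of the dissipation also pays for a Gevrey
weight whose parameter grows like the time (`gevreyWeight_mul_exp_le`). The condition `s > 2 - 2γ`
leaves room for a `δ > 1 - s` with `a < 1` (`exists_admissible`). Then `σ^{-a}` is integrable, and
Minkowski's inequality bounds the Duhamel term in `H^s`, with or without Gevrey weight, by a
constant which tends to zero with the length of the time interval (`lintegral_smoothing_sq_le`).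

Hence the Picard map contracts, for small `T`, the set of paths in `C([0,T], H^s)` for which
`e^{t(|∂₁|^α + |∂₂|^β)} θ(t)` has norm at most `2‖θ₀‖` at every time `t`. The set is closed because
the Gevrey norm is lower semicontinuous on `H^s` (`isClosed_gevreyEnergy_le`). This gives existence,
the norm bound and the Gevrey regularity of one solution at once (`exists_gevrey_solution`). The
same estimates without Gevrey weight, on successive short time steps, give uniqueness among all mild
solutions (`IsMildSolution.eqOn`). An arbitrary mild solution thus agrees on a short interval with
the Gevrey regular one.
-/

open scoped Topology

noncomputable section

namespace AQG

/-! ### The Fourier transform of a product -/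

open SchwartzMap in
/-- Both sides are compared through `𝓕 𝓕 h = h(-·)`, since Mathlib defines the convolution of
Schwartz functions as the inverse Fourier transform of the product of the Fourier transforms. -/
theorem fourier_mul_schwartz (f g : 𝓢(Plane, ℂ)) (ξ : Plane) :
    𝓕 (fun x => f x * g x) ξ = ∫ η, (𝓕 f : 𝓢(Plane, ℂ)) (ξ - η) * (𝓕 g : 𝓢(Plane, ℂ)) η := by
  have hrefl : ∀ (h : 𝓢(Plane, ℂ)) (x : Plane),
      (𝓕 (𝓕 h : 𝓢(Plane, ℂ)) : 𝓢(Plane, ℂ)) x = h (-x) := by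
    intro h x
    have h1 : (𝓕⁻ (𝓕 h : 𝓢(Plane, ℂ)) : 𝓢(Plane, ℂ)) (-x) = h (-x) := by
      rw [FourierTransform.fourierInv_fourier_eq]
    rw [← h1, SchwartzMap.fourierInv_coe, SchwartzMap.fourier_coe, Real.fourierInv_eq_fourier_neg,
      neg_neg]
  have key := SchwartzMap.convolution_apply (ContinuousLinearMap.mul ℂ ℂ) (𝓕 g : 𝓢(Plane, ℂ))
    (𝓕 f : 𝓢(Plane, ℂ)) ξ
  have h2 : (SchwartzMap.convolution (ContinuousLinearMap.mul ℂ ℂ) (𝓕 g : 𝓢(Plane, ℂ))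
      (𝓕 f : 𝓢(Plane, ℂ))) ξ = 𝓕 (fun x => f x * g x) ξ := by
    have h3 : (SchwartzMap.convolution (ContinuousLinearMap.mul ℂ ℂ) (𝓕 g : 𝓢(Plane, ℂ))
      (𝓕 f : 𝓢(Plane, ℂ))) = 𝓕⁻ (SchwartzMap.pairing (ContinuousLinearMap.mul ℂ ℂ)
        (𝓕 (𝓕 g : 𝓢(Plane, ℂ))) (𝓕 (𝓕 f : 𝓢(Plane, ℂ)))) := rfl
    rw [h3, SchwartzMap.fourierInv_coe, Real.fourierInv_eq_fourier_comp_neg]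
    refine congrArg (fun h : Plane → ℂ => 𝓕 h ξ) (funext fun x => ?_)
    simp only [SchwartzMap.pairing_apply_apply, hrefl, neg_neg, ContinuousLinearMap.mul_apply']
    ring
  rw [← h2, key]
  simp only [MeasureTheory.convolution, ContinuousLinearMap.mul_apply']
  congr 1
  ext η
  ring

/-- The product of two square integrable functions, as an integrable function. -/
def mulL1 (f g : L2) : Lp ℂ 1 (volume : Measure Plane) :=
  (ContinuousLinearMap.mul ℂ ℂ).holderL volume 2 2 1 f g

theorem coeFn_mulL1 (f g : L2) : mulL1 f g =ᵐ[volume] fun x => f x * g x :=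
  ContinuousLinearMap.coeFn_holder (r := 1) (ContinuousLinearMap.mul ℂ ℂ) f g

theorem continuous_mulL1 : Continuous fun p : L2 × L2 => mulL1 p.1 p.2 :=
  ((ContinuousLinearMap.mul ℂ ℂ).holderL volume 2 2 1).continuous₂

theorem fourier_mul_eq_fourierTransformCLM (f g : L2) (ξ : Plane) :
    𝓕 (fun x => f x * g x) ξ = Real.Lp.fourierTransformCLM Plane ℂ (mulL1 f g) ξ := by
  rw [Real.Lp.fourierTransformCLM_apply, Real.Lp.fourierTransform_apply]
  exact Real.fourier_congr_ae (coeFn_mulL1 f g).symm ξ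

theorem exists_integral_mul_eq_clm :
    ∃ Φ : L2 →L[ℂ] L2 →L[ℂ] ℂ, ∀ f g : L2, Φ f g = ∫ x, f x * g x :=
  ⟨(ContinuousLinearMap.mul ℂ ℂ).lpPairing volume 2 2, fun f g => by
    rw [ContinuousLinearMap.lpPairing_eq_integral]; rfl⟩

/-- The Fourier transform turns products of square integrable functions into convolutions. -/
theorem fourier_mul_eq_integral (f g : L2) (ξ : Plane) :
    𝓕 (fun x => f x * g x) ξ = ∫ η, (𝓕 f : L2) (ξ - η) * (𝓕 g : L2) η := by
  have hmp : MeasurePreserving (fun η : Plane => ξ - η) volume volume :=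
    Measure.measurePreserving_sub_left volume ξ
  obtain ⟨Φ, hΦ⟩ := exists_integral_mul_eq_clm
  have hR : ∀ f g : L2, ∫ η, (𝓕 f : L2) (ξ - η) * (𝓕 g : L2) η =
      Φ (Lp.compMeasurePreserving _ hmp (𝓕 f : L2)) (𝓕 g) := by
    intro f g
    rw [hΦ]
    refine integral_congr_ae ?_
    filter_upwards [Lp.coeFn_compMeasurePreserving (𝓕 f : L2) hmp] with η h
    rw [h, Function.comp_apply]
  have hF : Continuous fun f : L2 => (𝓕 f : L2) := FourierTransform.continuous_fourier
  have hL : Continuous fun p : L2 × L2 => 𝓕 (fun x => p.1 x * p.2 x) ξ := by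
    simp only [fourier_mul_eq_fourierTransformCLM]
    have h1 : Continuous fun p : L2 × L2 =>
        Real.Lp.fourierTransformCLM Plane ℂ (mulL1 p.1 p.2) :=
      (Real.Lp.fourierTransformCLM Plane ℂ).continuous.comp continuous_mulL1
    exact (BoundedContinuousFunction.lipschitz_eval_const ξ).continuous.comp h1
  have hR' : Continuous fun p : L2 × L2 => ∫ η, (𝓕 p.1 : L2) (ξ - η) * (𝓕 p.2 : L2) η := by
    simp only [hR]
    have h1 : Continuous fun p : L2 × L2 => Lp.compMeasurePreserving _ hmp (𝓕 p.1 : L2) :=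
      (Lp.isometry_compMeasurePreserving hmp).continuous.comp (hF.comp continuous_fst)
    exact (Φ.continuous.comp h1).clm_apply (hF.comp continuous_snd)
  -- both sides are continuous in `(f, g)`, so Schwartz functions suffice
  have hd : DenseRange (SchwartzMap.toLpCLM ℝ (E := Plane) ℂ 2 volume) :=
    SchwartzMap.denseRange_toLpCLM ENNReal.ofNat_ne_top
  refine hd.induction_on₂ (p := fun f g : L2 => 𝓕 (fun x => f x * g x) ξ =
    ∫ η, (𝓕 f : L2) (ξ - η) * (𝓕 g : L2) η) (isClosed_eq hL hR') (fun f g => ?_) f g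
  simp only [SchwartzMap.toLpCLM_apply, SchwartzMap.toLp_fourier_eq]
  have h1 : 𝓕 (fun x => (f.toLp 2 : L2) x * (g.toLp 2 : L2) x) ξ = 𝓕 (fun x => f x * g x) ξ := by
    refine Real.fourier_congr_ae ?_ ξ
    filter_upwards [f.coeFn_toLp 2, g.coeFn_toLp 2] with x h1 h2
    rw [h1, h2]
  rw [h1, fourier_mul_schwartz]
  refine (integral_congr_ae ?_).symm
  filter_upwards [hmp.quasiMeasurePreserving.ae_eq_comp
    ((𝓕 f : SchwartzMap Plane ℂ).coeFn_toLp 2 volume),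
    (𝓕 g : SchwartzMap Plane ℂ).coeFn_toLp 2] with x h1 h2
  simp only [Function.comp_apply] at h1
  rw [h1, h2]

theorem lintegral_comp_smul_le (c : ℝ) (hc : 1 ≤ c) (u : Plane → ℝ≥0∞) :
    ∫⁻ η, u (c • η) ≤ ∫⁻ η, u η := by
  have hc0 : c ≠ 0 := by positivity
  have hme : MeasurableEmbedding (fun η : Plane => c • η) :=
    (Homeomorph.smulOfNeZero c hc0).measurableEmbedding
  rw [← hme.lintegral_map, Measure.map_addHaar_smul volume hc0, lintegral_smul_measure, smul_eq_mul]
  refine mul_le_of_le_one_left zero_le ?_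
  rw [ENNReal.ofReal_le_one, abs_inv, abs_of_nonneg (by positivity)]
  exact inv_le_one_of_one_le₀ (one_le_pow₀ hc)

/-- Up to the constant `(2π)⁻² ≤ 1`, the Fourier transform of a product is dominated by the
convolution of the absolute values of the Fourier transforms. -/
theorem enorm_hatL1_mul_le (f g : L2) (ξ : Plane) :
    ‖hatL1 (fun x => f x * g x) ξ‖ₑ ≤ ∫⁻ η, ‖hat f (ξ - η)‖ₑ * ‖hat g η‖ₑ := by
  unfold hatL1
  rw [fourier_mul_eq_integral]
  refine (enorm_integral_le_lintegral_enorm _).trans ?_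
  simp only [enorm_mul]
  have hpi : (2 * Real.pi) ≠ 0 := by positivity
  refine le_trans (le_of_eq ?_) (lintegral_comp_smul_le (2 * Real.pi) ?_ _)
  · simp only [hat, smul_sub, smul_smul, inv_mul_cancel₀ hpi, one_smul]
  · nlinarith [Real.pi_gt_three]

/-! ### Sobolev spaces through the Fourier transform -/

/-- The power `(1 + |ξ|²)^{r/2}` of the Japanese bracket. -/
def bracket (r : ℝ) (ξ : Plane) : ℝ := (1 + ‖ξ‖ ^ 2) ^ (r / 2)

theorem bracket_pos (r : ℝ) (ξ : Plane) : 0 < bracket r ξ := by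
  unfold bracket; positivity

theorem one_le_bracket {r : ℝ} (hr : 0 ≤ r) (ξ : Plane) : 1 ≤ bracket r ξ :=
  Real.one_le_rpow (by nlinarith [sq_nonneg ‖ξ‖]) (by positivity)

theorem bracket_add (r q : ℝ) (ξ : Plane) : bracket (r + q) ξ = bracket r ξ * bracket q ξ := by
  unfold bracket
  rw [← Real.rpow_add (by positivity)]
  congr 1; ring

theorem continuous_bracket (r : ℝ) : Continuous (bracket r) := by
  unfold bracket
  refine Continuous.rpow_const (by fun_prop) fun ξ => Or.inl ?_
  positivity

theorem enorm_weightedHat (s : ℝ) (f : L2) (ξ : Plane) :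
    ‖weightedHat s f ξ‖ₑ = ENNReal.ofReal (bracket s ξ) * ‖hat f ξ‖ₑ := by
  unfold weightedHat
  rw [enorm_mul, ← ofReal_norm, Complex.norm_real, Real.norm_of_nonneg]
  · rfl
  · exact (bracket_pos s ξ).le

theorem eLpNorm_two_sq {X : Type*} [MeasurableSpace X] {μ : Measure X} (F : X → ℂ) :
    eLpNorm F 2 μ ^ 2 = ∫⁻ x, ‖F x‖ₑ ^ 2 ∂μ := by
  have := eLpNorm_nnreal_pow_eq_lintegral (μ := μ) (f := F) (p := 2) (by norm_num)
  norm_num at this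
  exact_mod_cast this

theorem memLp_two_of_lintegral_lt_top {X : Type*} [MeasurableSpace X] {μ : Measure X} {F : X → ℂ}
    (hF : AEStronglyMeasurable F μ) (h : ∫⁻ x, ‖F x‖ₑ ^ 2 ∂μ < ∞) : MemLp F 2 μ := by
  refine ⟨hF, ?_⟩
  rw [← eLpNorm_two_sq] at h
  by_contra hc
  rw [not_lt_top_iff.1 hc] at h
  simp at h

theorem Hs.enorm_sq {s : ℝ} (f : Hs s) :
    ‖f‖ₑ ^ 2 = ∫⁻ ξ, (ENNReal.ofReal (bracket s ξ) * ‖hat f.toL2 ξ‖ₑ) ^ 2 := by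
  have h1 : ‖f‖ₑ = ‖MemLp.toLp (weightedHat s f.toL2) f.memLp‖ₑ := by
    rw [← ofReal_norm, ← ofReal_norm]; rfl
  rw [h1, Lp.enorm_toLp, eLpNorm_two_sq]
  simp only [enorm_weightedHat]

theorem hat_sub (f g : L2) : hat (f - g) =ᵐ[volume] hat f - hat g := by
  rw [sub_eq_add_neg, sub_eq_add_neg]
  filter_upwards [hat_add f (-g), hat_neg g] with ξ h1 h2
  rw [h1, Pi.add_apply, Pi.add_apply, h2]

theorem Hs.toL2_sub {s : ℝ} (f g : Hs s) : (f - g).toL2 = f.toL2 - g.toL2 := rfl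

theorem exists_hat_eq {F : Plane → ℂ} (hF : MemLp F 2 volume) : ∃ f : L2, hat f =ᵐ[volume] F := by
  have hpi : (2 * Real.pi) ≠ 0 := by positivity
  have h1 : MemLp (fun η => F ((2 * Real.pi) • η)) 2 volume := by
    have h2 : MemLp F 2 (Measure.map (fun η : Plane => (2 * Real.pi) • η) volume) := by
      rw [Measure.map_addHaar_smul volume hpi]
      exact hF.smul_measure (by simp)
    exact h2.comp_of_map (by fun_prop)
  refine ⟨(𝓕⁻ (h1.toLp _) : L2), ?_⟩
  have h : ((𝓕 (𝓕⁻ (h1.toLp _) : L2) : L2) : Plane → ℂ) =ᵐ[volume]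
      fun η => F ((2 * Real.pi) • η) := by
    simp only [FourierTransform.fourier_fourierInv_eq]
    exact MemLp.coeFn_toLp _
  have h2 := (quasi_smul (c := (2 * Real.pi)⁻¹) (by positivity)).ae_eq_comp h
  filter_upwards [h2] with ξ hξ
  simpa only [Function.comp_apply, hat, smul_smul, mul_inv_cancel₀ hpi, one_smul] using hξ

/-- A function on the frequency side is the Fourier transform of an element of `H^s` as soon as it
has finite weighted `L²` norm. -/
theorem Hs.exists_hat_eq {s : ℝ} (hs : 0 ≤ s) {F : Plane → ℂ} (hF : AEStronglyMeasurable F volume)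
    (h : ∫⁻ ξ, (ENNReal.ofReal (bracket s ξ) * ‖F ξ‖ₑ) ^ 2 < ∞) :
    ∃ f : Hs s, hat f.toL2 =ᵐ[volume] F := by
  obtain ⟨f, hf⟩ := AQG.exists_hat_eq (F := F) <| by
    refine memLp_two_of_lintegral_lt_top hF (lt_of_le_of_lt (lintegral_mono fun ξ => ?_) h)
    gcongr
    exact le_mul_of_one_le_left' (by simpa using one_le_bracket hs ξ)
  refine ⟨⟨f, ?_⟩, hf⟩
  refine memLp_two_of_lintegral_lt_top ?_ ?_
  · exact AEStronglyMeasurable.mul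
      (Complex.continuous_ofReal.comp (continuous_bracket s)).aestronglyMeasurable
      (aestronglyMeasurable_hat f)
  · refine lt_of_le_of_lt (le_of_eq (lintegral_congr_ae ?_)) h
    filter_upwards [hf] with ξ hξ
    rw [enorm_weightedHat, hξ]

theorem toWeighted_surjective {s : ℝ} (hs : 0 ≤ s) : Function.Surjective (toWeighted s) := by
  intro G
  have hpos : ∀ ξ, (bracket s ξ : ℂ) ≠ 0 := fun ξ => Complex.ofReal_ne_zero.2 (bracket_pos s ξ).ne'
  obtain ⟨f, hf⟩ := Hs.exists_hat_eq (F := fun ξ => (bracket s ξ : ℂ)⁻¹ * G ξ) hs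
    (((Complex.continuous_ofReal.comp (continuous_bracket s)).inv₀ hpos).aestronglyMeasurable.mul
      (Lp.aestronglyMeasurable G)) <| by
    have : ∀ ξ, ENNReal.ofReal (bracket s ξ) * ‖(bracket s ξ : ℂ)⁻¹ * G ξ‖ₑ = ‖G ξ‖ₑ := by
      intro ξ
      rw [← ofReal_norm, ← ENNReal.ofReal_mul (bracket_pos s ξ).le, norm_mul, norm_inv,
        Complex.norm_real, Real.norm_of_nonneg (bracket_pos s ξ).le,
        mul_inv_cancel_left₀ (bracket_pos s ξ).ne', ofReal_norm]
    simp only [this]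
    rw [← eLpNorm_two_sq]
    exact ENNReal.pow_lt_top (Lp.eLpNorm_lt_top G)
  refine ⟨f, Lp.ext ?_⟩
  have h1 : toWeighted s f =ᵐ[volume] weightedHat s f.toL2 := MemLp.coeFn_toLp f.memLp
  filter_upwards [h1, hf] with ξ h1 h2
  rw [h1, weightedHat, h2]
  exact mul_inv_cancel_left₀ (hpos ξ) _

theorem isometry_toWeighted (s : ℝ) : Isometry (toWeighted s) :=
  AddMonoidHomClass.isometry_of_norm _ fun _ => rfl

theorem Hs.completeSpace {s : ℝ} (hs : 0 ≤ s) : CompleteSpace (Hs s) := by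
  have h := isometry_toWeighted s
  rw [h.isUniformInducing.completeSpace_congr (toWeighted_surjective hs)]
  infer_instance

/-- Plancherel's identity. -/
theorem lintegral_enorm_hat_sq (f : L2) :
    ∫⁻ ξ, ‖hat f ξ‖ₑ ^ 2 = ENNReal.ofReal ((2 * Real.pi) ^ 2) * ‖f‖ₑ ^ 2 := by
  have hc : (2 * Real.pi)⁻¹ ≠ 0 := by positivity
  have hme : MeasurableEmbedding (fun η : Plane => (2 * Real.pi)⁻¹ • η) :=
    (Homeomorph.smulOfNeZero _ hc).measurableEmbedding
  have h1 : ‖f‖ₑ = ‖(𝓕 f : L2)‖ₑ := by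
    rw [← ofReal_norm, ← ofReal_norm, Lp.norm_fourier_eq]
  have h2 := hme.lintegral_map (μ := volume) fun η => ‖(𝓕 f : L2) η‖ₑ ^ 2
  rw [Measure.map_addHaar_smul volume hc, lintegral_smul_measure, smul_eq_mul] at h2
  rw [h1, Lp.enorm_def, eLpNorm_two_sq]
  unfold hat
  rw [← h2]
  congr 2
  rw [finrank_euclideanSpace_fin, inv_pow, inv_inv, abs_of_nonneg (by positivity)]

theorem norm_le_of_enorm_hat_le {f g : L2} (h : ∀ᵐ ξ, ‖hat f ξ‖ₑ ≤ ‖hat g ξ‖ₑ) : ‖f‖ ≤ ‖g‖ := by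
  have h1 : ENNReal.ofReal ((2 * Real.pi) ^ 2) * ‖f‖ₑ ^ 2 ≤
      ENNReal.ofReal ((2 * Real.pi) ^ 2) * ‖g‖ₑ ^ 2 := by
    rw [← lintegral_enorm_hat_sq, ← lintegral_enorm_hat_sq]
    refine lintegral_mono_ae ?_
    filter_upwards [h] with ξ hξ
    gcongr
  rw [ENNReal.mul_le_mul_iff_right (by simp) (by simp)] at h1
  have h2 : ‖f‖ₑ ≤ ‖g‖ₑ := (ENNReal.pow_le_pow_left_iff two_ne_zero).1 h1
  exact enorm_le_iff_norm_le.1 h2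

theorem velocity_sub (j : Fin 2) (f g : L2) :
    velocity j (f - g) = velocity j f - velocity j g := by
  refine eq_of_hat_eq ?_
  filter_upwards [velocity_spec j f, velocity_spec j g, velocity_spec j (f - g), hat_sub f g,
    hat_sub (velocity j f) (velocity j g)] with ξ h1 h2 h3 h4 h5
  rw [h5, h3, h4, Pi.sub_apply, Pi.sub_apply, h1, h2, mul_sub]

theorem enorm_hat_velocity_le (j : Fin 2) (f : L2) :
    ∀ᵐ ξ, ‖hat (velocity j f) ξ‖ₑ ≤ ‖hat f ξ‖ₑ := by
  filter_upwards [velocity_spec j f] with ξ h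
  rw [h, enorm_mul]
  refine mul_le_of_le_one_left' ?_
  rw [← ofReal_norm, ENNReal.ofReal_le_one]
  exact norm_velocitySymbol_le j ξ

theorem continuous_velocity (j : Fin 2) : Continuous (velocity j) := by
  refine (LipschitzWith.of_dist_le_mul (K := 1) fun f g => ?_).continuous
  rw [dist_eq_norm, dist_eq_norm, ← velocity_sub, NNReal.coe_one, one_mul]
  exact norm_le_of_enorm_hat_le (enorm_hat_velocity_le j _)

theorem Hs.enorm_toL2_le {s : ℝ} (hs : 0 ≤ s) (f : Hs s) : ‖f.toL2‖ₑ ≤ ‖f‖ₑ := by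
  rw [← ENNReal.pow_le_pow_left_iff two_ne_zero, Hs.enorm_sq]
  calc ‖f.toL2‖ₑ ^ 2 ≤ ENNReal.ofReal ((2 * Real.pi) ^ 2) * ‖f.toL2‖ₑ ^ 2 := by
        refine le_mul_of_one_le_left' ?_
        rw [ENNReal.one_le_ofReal]
        nlinarith [Real.pi_gt_three]
    _ = ∫⁻ ξ, ‖hat f.toL2 ξ‖ₑ ^ 2 := (lintegral_enorm_hat_sq _).symm
    _ ≤ _ := by
        refine lintegral_mono fun ξ => ?_
        gcongr
        exact le_mul_of_one_le_left' (by simpa using one_le_bracket hs ξ)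

theorem Hs.continuous_toL2 {s : ℝ} (hs : 0 ≤ s) : Continuous (Hs.toL2 : Hs s → L2) := by
  refine (LipschitzWith.of_edist_le fun f g => ?_).continuous
  rw [edist_eq_enorm_sub, edist_eq_enorm_sub, ← Hs.toL2_sub]
  exact Hs.enorm_toL2_le hs _

/-! ### Inequalities for the symbols and weights -/

/-- The symbol `|ξ₁|^α + |ξ₂|^β` of `|∂₁|^α + |∂₂|^β`. -/
def gevreyExponent (α β : ℝ) (ξ : Plane) : ℝ := |ξ 0| ^ α + |ξ 1| ^ β

theorem gevreyExponent_nonneg (α β : ℝ) (ξ : Plane) : 0 ≤ gevreyExponent α β ξ := by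
  unfold gevreyExponent; positivity

theorem dissipationSymbol_nonneg (α β : ℝ) (ξ : Plane) : 0 ≤ dissipationSymbol α β ξ := by
  unfold dissipationSymbol; positivity

theorem continuous_gevreyExponent {α β : ℝ} (hα : 0 ≤ α) (hβ : 0 ≤ β) :
    Continuous (gevreyExponent α β) := by
  unfold gevreyExponent
  exact (Continuous.rpow_const (by fun_prop) fun _ => Or.inr hα).add
    (Continuous.rpow_const (by fun_prop) fun _ => Or.inr hβ)

theorem continuous_dissipationSymbol {α β : ℝ} (hα : 0 ≤ α) (hβ : 0 ≤ β) :
    Continuous (dissipationSymbol α β) :=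
  continuous_gevreyExponent (α := 2 * α) (β := 2 * β) (by positivity) (by positivity)

theorem abs_rpow_le_abs_sub_rpow_add {a : ℝ} (ha : 0 ≤ a) (ha1 : a ≤ 1) (x y : ℝ) :
    |x| ^ a ≤ |x - y| ^ a + |y| ^ a := by
  refine le_trans (Real.rpow_le_rpow (abs_nonneg _) ?_ ha)
    (Real.rpow_add_le_add_rpow (abs_nonneg _) (abs_nonneg _) ha ha1)
  simpa using abs_add_le (x - y) y

/-- Subadditivity of the Gevrey exponent, where `α, β ≤ 1` is used. -/
theorem gevreyExponent_le_sub_add {α β : ℝ} (hα : 0 ≤ α) (hα1 : α ≤ 1) (hβ : 0 ≤ β) (hβ1 : β ≤ 1)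
    (ξ η : Plane) :
    gevreyExponent α β ξ ≤ gevreyExponent α β (ξ - η) + gevreyExponent α β η := by
  have h1 := abs_rpow_le_abs_sub_rpow_add hα hα1 (ξ 0) (η 0)
  have h2 := abs_rpow_le_abs_sub_rpow_add hβ hβ1 (ξ 1) (η 1)
  simp only [gevreyExponent, PiLp.sub_apply]
  linarith

/-- Half of the dissipation dominates the Gevrey exponent, by `2x ≤ 1 + x²`. Hence the Gevrey weight
may grow with speed one in time without exhausting the smoothing of the heat semigroup. -/
theorem gevreyExponent_le (α β : ℝ) (ξ : Plane) :
    gevreyExponent α β ξ ≤ 1 + dissipationSymbol α β ξ / 2 := by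
  have h : ∀ a x : ℝ, |x| ^ a ≤ 1 / 2 + |x| ^ (2 * a) / 2 := fun a x => by
    rw [mul_comm, Real.rpow_mul (abs_nonneg x), Real.rpow_two]
    nlinarith [sq_nonneg (|x| ^ a - 1)]
  have h1 := h α (ξ 0)
  have h2 := h β (ξ 1)
  unfold gevreyExponent dissipationSymbol
  linarith

/-- The dissipation controls `2γ` derivatives for `γ ≤ min α β`. -/
theorem bracket_le_dissipationSymbol {α β γ : ℝ} (hγ : 0 ≤ γ) (hγ1 : γ ≤ 1) (hα : γ ≤ α)
    (hβ : γ ≤ β) (ξ : Plane) : bracket (2 * γ) ξ ≤ 3 + dissipationSymbol α β ξ := by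
  have h : ∀ a x : ℝ, γ ≤ a → (x ^ 2) ^ γ ≤ 1 + |x| ^ (2 * a) := fun a x ha => by
    rw [← sq_abs, ← Real.rpow_two, ← Real.rpow_mul (abs_nonneg x)]
    rcases le_total |x| 1 with hx | hx
    · have := Real.rpow_le_one (abs_nonneg x) hx (z := 2 * γ) (by positivity)
      have := Real.rpow_nonneg (abs_nonneg x) (2 * a)
      linarith
    · have := Real.rpow_le_rpow_of_exponent_le hx (y := 2 * γ) (z := 2 * a) (by linarith)
      linarith
  have h1 := h α (ξ 0) hα
  have h2 := h β (ξ 1) hβ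
  have h3 := Real.rpow_add_le_add_rpow (a := 1 + (ξ 0) ^ 2) (b := (ξ 1) ^ 2) (by positivity)
    (by positivity) hγ hγ1
  have h4 := Real.rpow_add_le_add_rpow (a := 1) (b := (ξ 0) ^ 2) (by positivity)
    (by positivity) hγ hγ1
  have h5 : ‖ξ‖ ^ 2 = (ξ 0) ^ 2 + (ξ 1) ^ 2 := by
    rw [EuclideanSpace.real_norm_sq_eq, Fin.sum_univ_two]
  unfold bracket dissipationSymbol
  rw [h5, mul_div_cancel_left₀ _ two_ne_zero, ← add_assoc]
  rw [Real.one_rpow] at h4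
  linarith

/-- Parabolic smoothing: `e^{-σA/2}` gains `2γa` derivatives at the price of `σ^{-a}`. -/
theorem bracket_mul_exp_le {α β γ a σ T : ℝ} (hγ : 0 ≤ γ) (hγ1 : γ ≤ 1) (hα : γ ≤ α)
    (hβ : γ ≤ β) (ha : 0 ≤ a) (ha1 : a ≤ 1) (hσ : 0 < σ) (hσT : σ ≤ T) (ξ : Plane) :
    bracket (2 * γ * a) ξ * Real.exp (-(σ * dissipationSymbol α β ξ / 2)) ≤
      (3 + 3 * T) * σ ^ (-a) := by
  set A := dissipationSymbol α β ξ with hA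
  have hA0 : 0 ≤ A := dissipationSymbol_nonneg α β ξ
  have h1 : bracket (2 * γ * a) ξ ≤ (3 + A) ^ a := by
    have h2 : bracket (2 * γ * a) ξ = bracket (2 * γ) ξ ^ a := by
      unfold bracket
      rw [← Real.rpow_mul (by positivity)]
      congr 1; ring
    rw [h2]
    exact Real.rpow_le_rpow (bracket_pos _ _).le (bracket_le_dissipationSymbol hγ hγ1 hα hβ ξ) ha
  have h3 : σ ^ a * (3 + A) ^ a ≤ 1 + σ * (3 + A) := by
    rw [← Real.mul_rpow hσ.le (by positivity)]
    have h0 : 0 ≤ σ * (3 + A) := by positivity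
    rcases le_total (σ * (3 + A)) 1 with h | h
    · have := Real.rpow_le_one h0 h ha
      linarith
    · have := Real.rpow_le_rpow_of_exponent_le h ha1
      rw [Real.rpow_one] at this
      linarith
  set E := Real.exp (-(σ * A / 2)) with hE
  have hE0 : 0 < E := Real.exp_pos _
  have hE1 : E ≤ 1 := Real.exp_le_one_iff.2 (by have : 0 ≤ σ * A := by positivity
                                                linarith)
  have h4 : σ * A * E ≤ 2 := by
    have h5 : σ * A / 2 ≤ Real.exp (σ * A / 2) := by linarith [Real.add_one_le_exp (σ * A / 2)]
    have h6 : Real.exp (σ * A / 2) * E = 1 := by rw [hE, ← Real.exp_add]; simp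
    nlinarith
  have h7 : σ ^ a * σ ^ (-a) = 1 := by rw [← Real.rpow_add hσ]; simp
  have h8 : 0 < σ ^ (-a) := Real.rpow_pos_of_pos hσ _
  calc bracket (2 * γ * a) ξ * E ≤ (3 + A) ^ a * E := by gcongr
    _ = (σ ^ a * (3 + A) ^ a) * E * σ ^ (-a) := by linear_combination (-(3 + A) ^ a * E) * h7
    _ ≤ (1 + σ * (3 + A)) * E * σ ^ (-a) := by gcongr
    _ ≤ (3 + 3 * T) * σ ^ (-a) := by
      gcongr
      nlinarith

/-- Here `X` stands for the bracket of `ξ`, and `Y`, `Z` for those of two frequencies with sum `ξ`,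
of which the first is high: `Y^{-s}` absorbs `X^s`, and the smaller of `X` and `Z` takes the rest.
-/
theorem rpow_mul_rpow_mul_rpow_le {X Y Z s δ : ℝ} (hX : 0 < X) (hY : 0 < Y) (hZ : 0 < Z)
    (hs : 0 ≤ s) (hδ : 0 ≤ δ) (h : X ≤ 2 * Y) :
    X ^ (s - δ) * (Y ^ (-s) * Z ^ (-s)) ≤ 2 ^ s * (X ^ (-(s + δ)) + Z ^ (-(s + δ))) := by
  have h1 : X ^ s * Y ^ (-s) ≤ 2 ^ s := by
    have h2 := Real.rpow_le_rpow hX.le h hs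
    rw [Real.mul_rpow two_pos.le hY.le] at h2
    rw [Real.rpow_neg hY.le, ← div_eq_mul_inv, div_le_iff₀ (by positivity)]
    exact h2
  have h3 : X ^ (-δ) * Z ^ (-s) ≤ X ^ (-(s + δ)) + Z ^ (-(s + δ)) := by
    have hx : X ^ (-(s + δ)) = X ^ (-δ) * X ^ (-s) := by
      rw [← Real.rpow_add hX]; congr 1; ring
    have hz : Z ^ (-(s + δ)) = Z ^ (-δ) * Z ^ (-s) := by
      rw [← Real.rpow_add hZ]; congr 1; ring
    rcases le_total X Z with hXZ | hXZ
    · have : Z ^ (-s) ≤ X ^ (-s) := Real.rpow_le_rpow_of_nonpos hX hXZ (by linarith)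
      have h5 : X ^ (-δ) * Z ^ (-s) ≤ X ^ (-(s + δ)) := by rw [hx]; gcongr
      have : 0 ≤ Z ^ (-(s + δ)) := by positivity
      linarith
    · have : X ^ (-δ) ≤ Z ^ (-δ) := Real.rpow_le_rpow_of_nonpos hZ hXZ (by linarith)
      have h5 : X ^ (-δ) * Z ^ (-s) ≤ Z ^ (-(s + δ)) := by rw [hz]; gcongr
      have : 0 ≤ X ^ (-(s + δ)) := by positivity
      linarith
  calc X ^ (s - δ) * (Y ^ (-s) * Z ^ (-s)) = (X ^ s * Y ^ (-s)) * (X ^ (-δ) * Z ^ (-s)) := by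
        rw [sub_eq_add_neg, Real.rpow_add hX]; ring
    _ ≤ _ := by gcongr

theorem bracket_eq_rpow (r : ℝ) (ξ : Plane) : bracket r ξ = bracket 1 ξ ^ r := by
  unfold bracket
  rw [← Real.rpow_mul (by positivity)]
  congr 1; ring

theorem bracket_one_sq (ξ : Plane) : bracket 1 ξ ^ 2 = 1 + ‖ξ‖ ^ 2 := by
  unfold bracket
  rw [← Real.sqrt_eq_rpow, Real.sq_sqrt (by positivity)]

theorem norm_le_bracket_one (ξ : Plane) : ‖ξ‖ ≤ bracket 1 ξ := by
  rw [← pow_le_pow_iff_left₀ (norm_nonneg _) (bracket_pos 1 ξ).le two_ne_zero]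
  rw [bracket_one_sq]; linarith

theorem bracket_one_le_or (ξ η : Plane) :
    bracket 1 ξ ≤ 2 * bracket 1 (ξ - η) ∨ bracket 1 ξ ≤ 2 * bracket 1 η := by
  by_contra! h
  have h1 := bracket_one_sq ξ
  have h2 := bracket_one_sq η
  have h3 := bracket_one_sq (ξ - η)
  have h4 : ‖ξ‖ ≤ ‖ξ - η‖ + ‖η‖ := by simpa using norm_add_le (ξ - η) η
  have h5 := bracket_pos 1 η
  have h6 := bracket_pos 1 (ξ - η)
  have h7 : ‖ξ‖ ^ 2 ≤ 2 * ‖ξ - η‖ ^ 2 + 2 * ‖η‖ ^ 2 := by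
    nlinarith [norm_nonneg ξ, sq_nonneg (‖ξ - η‖ - ‖η‖)]
  nlinarith

/-- The weights in the product estimate: the high frequency factor absorbs `⟨ξ⟩^s`, and the
remaining weights are redistributed to a single factor with exponent `s + δ`. -/
theorem bracket_product_le {s δ : ℝ} (hs : 0 ≤ s) (hδ : 0 ≤ δ) (ξ η : Plane) :
    bracket (s - δ) ξ * (bracket (-s) (ξ - η) * bracket (-s) η) ≤
      2 ^ s * (bracket (-(s + δ)) ξ + bracket (-(s + δ)) η + bracket (-(s + δ)) (ξ - η)) := by
  simp only [bracket_eq_rpow (s - δ), bracket_eq_rpow (-s), bracket_eq_rpow (-(s + δ))]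
  have hX := bracket_pos 1 ξ
  have hY := bracket_pos 1 (ξ - η)
  have hZ := bracket_pos 1 η
  have h2 : (0 : ℝ) < 2 ^ s := by positivity
  have hy : 0 < bracket 1 (ξ - η) ^ (-(s + δ)) := by positivity
  have hz : 0 < bracket 1 η ^ (-(s + δ)) := by positivity
  rcases bracket_one_le_or ξ η with h | h
  · refine (rpow_mul_rpow_mul_rpow_le hX hY hZ hs hδ h).trans
      (mul_le_mul_of_nonneg_left (by linarith) h2.le)
  · rw [mul_comm (bracket 1 (ξ - η) ^ (-s))]
    refine (rpow_mul_rpow_mul_rpow_le hX hZ hY hs hδ h).trans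
      (mul_le_mul_of_nonneg_left (by linarith) h2.le)

theorem lintegral_bracket_sq_lt_top {p : ℝ} (hp : 1 < p) :
    ∫⁻ ξ, ENNReal.ofReal (bracket (-p) ξ) ^ 2 < ∞ := by
  have h := (integrable_rpow_neg_one_add_norm_sq (E := Plane) (μ := volume) (r := 2 * p)
    (by simp; linarith)).lintegral_lt_top
  refine lt_of_le_of_lt (le_of_eq (lintegral_congr fun ξ => ?_)) h
  rw [← ENNReal.ofReal_pow (bracket_pos _ _).le, bracket, ← Real.rpow_natCast, ← Real.rpow_mul
    (by positivity)]
  congr 2; push_cast; ring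

/-! ### Weighted convolution estimates -/

theorem lintegral_mul_sq_le {X : Type*} [MeasurableSpace X] (μ : Measure X) {F G : X → ℝ≥0∞}
    (hF : AEMeasurable F μ) (hG : AEMeasurable G μ) :
    (∫⁻ x, F x * G x ∂μ) ^ 2 ≤ (∫⁻ x, F x ^ 2 ∂μ) * ∫⁻ x, G x ^ 2 ∂μ := by
  have h := ENNReal.lintegral_mul_le_Lp_mul_Lq μ Real.HolderConjugate.two_two hF hG
  have h2 := pow_le_pow_left' h 2
  simp only [ENNReal.rpow_two, Pi.mul_apply] at h2
  refine h2.trans (le_of_eq ?_)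
  rw [mul_pow, ← ENNReal.rpow_two, ← ENNReal.rpow_two, ← ENNReal.rpow_mul, ← ENNReal.rpow_mul]
  norm_num

/-- Minkowski's integral inequality, for the `L²` norm and a uniform bound on the slices. By
applying it to a measure `ν` with a density, one obtains weighted versions. -/
theorem lintegral_lintegral_sq_le {X Y : Type*} [MeasurableSpace X] [MeasurableSpace Y]
    {μ : Measure X} {ν : Measure Y} [SFinite μ] [SFinite ν] {h : Y → X → ℝ≥0∞}
    (hh : Measurable (Function.uncurry h)) {B : ℝ≥0∞}
    (hB : ∀ᵐ y ∂ν, ∫⁻ x, h y x ^ 2 ∂μ ≤ B) :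
    ∫⁻ x, (∫⁻ y, h y x ∂ν) ^ 2 ∂μ ≤ ν univ ^ 2 * B := by
  calc ∫⁻ x, (∫⁻ y, h y x ∂ν) ^ 2 ∂μ ≤ ∫⁻ x, ν univ * ∫⁻ y, h y x ^ 2 ∂ν ∂μ := by
        refine lintegral_mono fun x => ?_
        have := lintegral_mul_sq_le ν (F := fun _ => 1) (G := fun y => h y x) aemeasurable_const
          (hh.comp measurable_prodMk_right).aemeasurable
        simpa using this
    _ = ν univ * ∫⁻ y, ∫⁻ x, h y x ^ 2 ∂μ ∂ν := by
        rw [lintegral_const_mul, lintegral_lintegral_swap]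
        · exact ((hh.comp measurable_swap).pow_const 2).aemeasurable
        · exact ((hh.comp measurable_swap).pow_const 2).lintegral_prod_right'
    _ ≤ ν univ * ∫⁻ _, B ∂ν := mul_le_mul_right (lintegral_mono_ae hB) _
    _ = _ := by rw [lintegral_const]; ring

/-- The convolution of nonnegative functions on the plane. -/
def conv (F G : Plane → ℝ≥0∞) (ξ : Plane) : ℝ≥0∞ := ∫⁻ η, F (ξ - η) * G η

theorem conv_comm (F G : Plane → ℝ≥0∞) (ξ : Plane) : conv F G ξ = conv G F ξ := by
  unfold conv
  rw [← lintegral_sub_left_eq_self _ ξ]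
  simp only [sub_sub_cancel, mul_comm]

theorem measurable_conv {F G : Plane → ℝ≥0∞} (hF : Measurable F) (hG : Measurable G) :
    Measurable (conv F G) := by
  have h : Measurable fun p : Plane × Plane => F (p.1 - p.2) * G p.2 :=
    (hF.comp (measurable_fst.sub measurable_snd)).mul (hG.comp measurable_snd)
  exact h.lintegral_prod_right'

theorem conv_sq_le {F G : Plane → ℝ≥0∞} (hF : Measurable F) (hG : Measurable G) (ξ : Plane) :
    conv F G ξ ^ 2 ≤ (∫⁻ η, F η ^ 2) * ∫⁻ η, G η ^ 2 := by
  refine (lintegral_mul_sq_le volume (hF.comp (by fun_prop)).aemeasurable hG.aemeasurable).trans ?_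
  simp only [Function.comp_apply]
  rw [lintegral_sub_left_eq_self (fun η => F η ^ 2) ξ]

/-- Young's inequality `L² * L¹ ⊆ L²`. -/
theorem lintegral_conv_sq_le {F G : Plane → ℝ≥0∞} (hF : Measurable F) (hG : Measurable G) :
    ∫⁻ ξ, conv F G ξ ^ 2 ≤ (∫⁻ η, F η ^ 2) * (∫⁻ η, G η) ^ 2 := by
  have h := lintegral_lintegral_sq_le (μ := (volume : Measure Plane))
    (ν := (volume : Measure Plane).withDensity G) (h := fun η ξ => F (ξ - η))
    (hF.comp (by fun_prop)) (B := ∫⁻ η, F η ^ 2)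
    (Eventually.of_forall fun η => (lintegral_sub_right_eq_self (fun ξ => F ξ ^ 2) η).le)
  rw [withDensity_apply _ MeasurableSet.univ, Measure.restrict_univ, mul_comm] at h
  refine le_trans (le_of_eq (lintegral_congr fun ξ => ?_)) h
  have hm : Measurable fun η => F (ξ - η) := hF.comp (by fun_prop)
  rw [lintegral_withDensity_eq_lintegral_mul _ hG hm]
  simp only [conv, Pi.mul_apply, mul_comm]

theorem lintegral_conv_mul_sq_le {F G k : Plane → ℝ≥0∞} (hF : Measurable F) (hG : Measurable G)
    (hk : Measurable k) :
    ∫⁻ ξ, conv F (fun η => k η * G η) ξ ^ 2 ≤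
      (∫⁻ η, k η ^ 2) * (∫⁻ η, F η ^ 2) * ∫⁻ η, G η ^ 2 := by
  refine (lintegral_conv_sq_le hF (hk.mul hG)).trans ?_
  have h := lintegral_mul_sq_le volume hk.aemeasurable hG.aemeasurable
  calc _ ≤ (∫⁻ η, F η ^ 2) * ((∫⁻ η, k η ^ 2) * ∫⁻ η, G η ^ 2) := by gcongr; exact h
    _ = _ := by ring

theorem add_add_sq_le (a b c : ℝ≥0∞) : (a + b + c) ^ 2 ≤ 9 * (a ^ 2 + b ^ 2 + c ^ 2) := by
  have key : ∀ m : ℝ≥0∞, a ≤ m → b ≤ m → c ≤ m → m ^ 2 ≤ a ^ 2 + b ^ 2 + c ^ 2 →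
      (a + b + c) ^ 2 ≤ 9 * (a ^ 2 + b ^ 2 + c ^ 2) := fun m ha hb hc hm => by
    calc (a + b + c) ^ 2 ≤ (m + m + m) ^ 2 := by gcongr
      _ = 9 * m ^ 2 := by ring
      _ ≤ _ := by gcongr
  rcases le_total a b with hab | hab <;> rcases le_total b c with hbc | hbc <;>
    rcases le_total a c with hac | hac
  · exact key c hac hbc le_rfl le_add_self
  · exact key c (hab.trans hbc) hbc le_rfl le_add_self
  · exact key b hab le_rfl hbc (le_add_right le_add_self)
  · exact key b hab le_rfl hbc (le_add_right le_add_self)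
  · exact key c hac hbc le_rfl le_add_self
  · exact key a le_rfl hab hac (le_add_right le_self_add)
  · exact key a le_rfl hab (hbc.trans hab) (le_add_right le_self_add)
  · exact key a le_rfl hab hac (le_add_right le_self_add)

theorem measurable_ofReal_bracket (r : ℝ) :
    Measurable fun ξ => ENNReal.ofReal (bracket r ξ) :=
  (continuous_bracket r).measurable.ennreal_ofReal

/-- The constant in the product estimate; it is finite only for `s + δ > 1`. -/
def productConst (s δ : ℝ) : ℝ≥0∞ :=
  ENNReal.ofReal (2 ^ s) ^ 2 * (27 * ∫⁻ ξ, ENNReal.ofReal (bracket (-(s + δ)) ξ) ^ 2)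

theorem productConst_lt_top {s δ : ℝ} (h : 1 < s + δ) : productConst s δ < ∞ := by
  refine ENNReal.mul_lt_top (by finiteness) (ENNReal.mul_lt_top (by finiteness) ?_)
  exact lintegral_bracket_sq_lt_top h

/-- The product law `H^s · H^s ⊆ H^{s-δ}`, for weighted convolutions. -/
theorem lintegral_bracket_conv_sq_le {s δ : ℝ} (hs : 0 ≤ s) (hδ : 0 ≤ δ) {F G : Plane → ℝ≥0∞}
    (hF : Measurable F) (hG : Measurable G) :
    ∫⁻ ξ, (ENNReal.ofReal (bracket (s - δ) ξ) *
        conv (fun η => ENNReal.ofReal (bracket (-s) η) * F η)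
          (fun η => ENNReal.ofReal (bracket (-s) η) * G η) ξ) ^ 2 ≤
      productConst s δ * (∫⁻ ξ, F ξ ^ 2) * ∫⁻ ξ, G ξ ^ 2 := by
  set k : Plane → ℝ≥0∞ := fun ξ => ENNReal.ofReal (bracket (-(s + δ)) ξ) with hk
  have hkm : Measurable k := measurable_ofReal_bracket _
  have hpt : ∀ ξ, ENNReal.ofReal (bracket (s - δ) ξ) *
        conv (fun η => ENNReal.ofReal (bracket (-s) η) * F η)
          (fun η => ENNReal.ofReal (bracket (-s) η) * G η) ξ ≤
      ENNReal.ofReal (2 ^ s) * (k ξ * conv F G ξ + conv F (fun η => k η * G η) ξ +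
        conv G (fun η => k η * F η) ξ) := by
    intro ξ
    rw [conv_comm G]
    have hFm : Measurable fun η => F (ξ - η) := hF.comp (by fun_prop)
    have hkm' : Measurable fun η => k (ξ - η) := hkm.comp (by fun_prop)
    unfold conv
    rw [← lintegral_const_mul' _ _ ENNReal.ofReal_ne_top, ← lintegral_const_mul' _ _ (by simp [hk]),
      ← lintegral_add_left (by fun_prop), ← lintegral_add_left (by fun_prop),
      ← lintegral_const_mul' _ _ ENNReal.ofReal_ne_top]
    refine lintegral_mono fun η => ?_
    have hb := ENNReal.ofReal_le_ofReal (bracket_product_le hs hδ ξ η)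
    have h0 := fun r ζ => (bracket_pos r ζ).le
    rw [ENNReal.ofReal_mul (h0 _ _), ENNReal.ofReal_mul (h0 _ _),
      ENNReal.ofReal_mul (by positivity),
      ENNReal.ofReal_add (add_nonneg (h0 _ _) (h0 _ _)) (h0 _ _),
      ENNReal.ofReal_add (h0 _ _) (h0 _ _)] at hb
    calc _ = (ENNReal.ofReal (bracket (s - δ) ξ) * (ENNReal.ofReal (bracket (-s) (ξ - η)) *
            ENNReal.ofReal (bracket (-s) η))) * (F (ξ - η) * G η) := by ring
      _ ≤ _ := mul_le_mul_left hb _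
      _ = _ := by simp only [hk]; ring
  have h1 : ∫⁻ ξ, (k ξ * conv F G ξ) ^ 2 ≤
      (∫⁻ ξ, k ξ ^ 2) * (∫⁻ ξ, F ξ ^ 2) * ∫⁻ ξ, G ξ ^ 2 := by
    rw [mul_assoc, ← lintegral_mul_const _ (hkm.pow_const 2)]
    refine lintegral_mono fun ξ => ?_
    rw [mul_pow]
    gcongr
    exact conv_sq_le hF hG ξ
  have h2 := lintegral_conv_mul_sq_le hF hG hkm
  have h3 := lintegral_conv_mul_sq_le hG hF hkm
  have m1 : Measurable fun ξ => (k ξ * conv F G ξ) ^ 2 :=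
    (hkm.mul (measurable_conv hF hG)).pow_const 2
  have m2 : Measurable fun ξ => conv F (fun η => k η * G η) ξ ^ 2 :=
    (measurable_conv hF (hkm.mul hG)).pow_const 2
  have m12 : Measurable fun ξ => (k ξ * conv F G ξ) ^ 2 + conv F (fun η => k η * G η) ξ ^ 2 :=
    m1.add m2
  calc _ ≤ ∫⁻ ξ, (ENNReal.ofReal (2 ^ s) ^ 2 * 9) * ((k ξ * conv F G ξ) ^ 2 +
        conv F (fun η => k η * G η) ξ ^ 2 + conv G (fun η => k η * F η) ξ ^ 2) := by
        refine lintegral_mono fun ξ => ?_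
        refine (pow_le_pow_left' (hpt ξ) 2).trans ?_
        rw [mul_pow, mul_assoc]
        gcongr
        exact add_add_sq_le _ _ _
    _ = (ENNReal.ofReal (2 ^ s) ^ 2 * 9) * ((∫⁻ ξ, (k ξ * conv F G ξ) ^ 2) +
        (∫⁻ ξ, conv F (fun η => k η * G η) ξ ^ 2) + ∫⁻ ξ, conv G (fun η => k η * F η) ξ ^ 2) := by
        rw [lintegral_const_mul' _ _ (by finiteness), ← lintegral_add_left m1,
          ← lintegral_add_left m12]
    _ ≤ (ENNReal.ofReal (2 ^ s) ^ 2 * 9) * ((∫⁻ ξ, k ξ ^ 2) * (∫⁻ ξ, F ξ ^ 2) * (∫⁻ ξ, G ξ ^ 2) +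
        (∫⁻ ξ, k ξ ^ 2) * (∫⁻ ξ, F ξ ^ 2) * (∫⁻ ξ, G ξ ^ 2) +
        (∫⁻ ξ, k ξ ^ 2) * (∫⁻ ξ, G ξ ^ 2) * (∫⁻ ξ, F ξ ^ 2)) := by gcongr
    _ = _ := by unfold productConst; ring

/-! ### Gevrey energies -/

/-- The weight `⟨ξ⟩^s e^{τ(|ξ₁|^α + |ξ₂|^β)}`. -/
def gevreyWeight (α β s τ : ℝ) (ξ : Plane) : ℝ :=
  bracket s ξ * Real.exp (τ * gevreyExponent α β ξ)

theorem gevreyWeight_pos (α β s τ : ℝ) (ξ : Plane) : 0 < gevreyWeight α β s τ ξ :=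
  mul_pos (bracket_pos s ξ) (Real.exp_pos _)

/-- The square of the `H^s` norm of `e^{τ(|∂₁|^α + |∂₂|^β)} f`, possibly infinite. -/
def gevreyEnergy (α β s τ : ℝ) (f : L2) : ℝ≥0∞ :=
  ∫⁻ ξ, (ENNReal.ofReal (gevreyWeight α β s τ ξ) * ‖hat f ξ‖ₑ) ^ 2

theorem gevreyEnergy_zero (α β : ℝ) {s : ℝ} (f : Hs s) :
    gevreyEnergy α β s 0 f.toL2 = ‖f‖ₑ ^ 2 := by
  rw [Hs.enorm_sq, gevreyEnergy]
  simp [gevreyWeight]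

theorem measurable_gevreyWeight {α β : ℝ} (hα : 0 ≤ α) (hβ : 0 ≤ β) (s τ : ℝ) :
    Measurable (gevreyWeight α β s τ) :=
  (continuous_bracket s).measurable.mul
    ((continuous_gevreyExponent hα hβ).measurable.const_mul τ).exp

theorem enorm_hatDivFlux_le (f g : L2) (ξ : Plane) :
    ‖hatDivFlux f g ξ‖ₑ ≤ ENNReal.ofReal (bracket 1 ξ) *
      (2 * conv (fun η => ‖hat f η‖ₑ) (fun η => ‖hat g η‖ₑ) ξ) := by
  unfold hatDivFlux
  refine (enorm_sum_le _ _).trans ?_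
  have h : ∀ j : Fin 2, ‖Complex.I * (ξ j : ℂ) * hatL1 (fun x => f x * velocity j g x) ξ‖ₑ ≤
      ENNReal.ofReal (bracket 1 ξ) * conv (fun η => ‖hat f η‖ₑ) (fun η => ‖hat g η‖ₑ) ξ := by
    intro j
    rw [enorm_mul]
    gcongr
    · rw [← ofReal_norm]
      refine ENNReal.ofReal_le_ofReal ?_
      rw [norm_mul, Complex.norm_I, one_mul, Complex.norm_real]
      exact (PiLp.norm_apply_le ξ j).trans (norm_le_bracket_one ξ)
    · refine (enorm_hatL1_mul_le f (velocity j g) ξ).trans (lintegral_mono_ae ?_)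
      filter_upwards [enorm_hat_velocity_le j g] with η hη
      gcongr
  refine (Finset.sum_le_sum fun j _ => h j).trans (le_of_eq ?_)
  simp only [Finset.sum_const, Finset.card_univ, Fintype.card_fin, nsmul_eq_mul]
  push_cast
  ring

/-- The basic bilinear estimate: `div (f u_g)` loses `1 + δ` derivatives, and the Gevrey weight is
distributed over both factors by its subadditivity. -/
theorem lintegral_hatDivFlux_sq_le {α β s δ τ : ℝ} (hα : 0 ≤ α) (hα1 : α ≤ 1) (hβ : 0 ≤ β)
    (hβ1 : β ≤ 1) (hs : 0 ≤ s) (hδ : 0 ≤ δ) (hτ : 0 ≤ τ) (f g : L2) :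
    ∫⁻ ξ, (ENNReal.ofReal (gevreyWeight α β (s - δ - 1) τ ξ) * ‖hatDivFlux f g ξ‖ₑ) ^ 2 ≤
      4 * productConst s δ * gevreyEnergy α β s τ f * gevreyEnergy α β s τ g := by
  set W : Plane → ℝ≥0∞ := fun ξ => ENNReal.ofReal (gevreyWeight α β s τ ξ) with hW
  have hWm : Measurable W := (measurable_gevreyWeight hα hβ s τ).ennreal_ofReal
  set f' := (aestronglyMeasurable_hat f).mk with hf'
  set g' := (aestronglyMeasurable_hat g).mk with hg'
  have hf : hat f =ᵐ[volume] f' := (aestronglyMeasurable_hat f).ae_eq_mk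
  have hg : hat g =ᵐ[volume] g' := (aestronglyMeasurable_hat g).ae_eq_mk
  have hfm : Measurable fun ξ => W ξ * ‖f' ξ‖ₑ :=
    hWm.mul (aestronglyMeasurable_hat f).stronglyMeasurable_mk.enorm
  have hgm : Measurable fun ξ => W ξ * ‖g' ξ‖ₑ :=
    hWm.mul (aestronglyMeasurable_hat g).stronglyMeasurable_mk.enorm
  have hEf : gevreyEnergy α β s τ f = ∫⁻ ξ, (W ξ * ‖f' ξ‖ₑ) ^ 2 :=
    lintegral_congr_ae (hf.mono fun ξ h => by simp only [h, hW])
  have hEg : gevreyEnergy α β s τ g = ∫⁻ ξ, (W ξ * ‖g' ξ‖ₑ) ^ 2 :=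
    lintegral_congr_ae (hg.mono fun ξ h => by simp only [h, hW])
  rw [hEf, hEg]
  have hpt : ∀ ξ, ENNReal.ofReal (gevreyWeight α β (s - δ - 1) τ ξ) * ‖hatDivFlux f g ξ‖ₑ ≤
      2 * (ENNReal.ofReal (bracket (s - δ) ξ) *
        conv (fun η => ENNReal.ofReal (bracket (-s) η) * (W η * ‖f' η‖ₑ))
          (fun η => ENNReal.ofReal (bracket (-s) η) * (W η * ‖g' η‖ₑ)) ξ) := by
    intro ξ
    have h1 : ENNReal.ofReal (Real.exp (τ * gevreyExponent α β ξ)) *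
        conv (fun η => ‖hat f η‖ₑ) (fun η => ‖hat g η‖ₑ) ξ ≤
        conv (fun η => ENNReal.ofReal (bracket (-s) η) * (W η * ‖f' η‖ₑ))
          (fun η => ENNReal.ofReal (bracket (-s) η) * (W η * ‖g' η‖ₑ)) ξ := by
      unfold conv
      rw [← lintegral_const_mul' _ _ ENNReal.ofReal_ne_top]
      refine lintegral_mono_ae ?_
      filter_upwards
        [(Measure.measurePreserving_sub_left volume ξ).quasiMeasurePreserving.ae_eq_comp hf, hg]
        with η h2 h3
      simp only [Function.comp_apply] at h2
      rw [h2, h3]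
      have hw : ∀ ζ, ENNReal.ofReal (bracket (-s) ζ) * W ζ =
          ENNReal.ofReal (Real.exp (τ * gevreyExponent α β ζ)) := by
        intro ζ
        rw [hW, ← ENNReal.ofReal_mul (bracket_pos _ _).le, gevreyWeight, ← mul_assoc,
          ← bracket_add, neg_add_cancel]
        simp [bracket]
      rw [← mul_assoc (ENNReal.ofReal (bracket (-s) (ξ - η))),
        ← mul_assoc (ENNReal.ofReal (bracket (-s) η)), hw, hw]
      calc _ ≤ (ENNReal.ofReal (Real.exp (τ * gevreyExponent α β (ξ - η))) *
            ENNReal.ofReal (Real.exp (τ * gevreyExponent α β η))) * (‖f' (ξ - η)‖ₑ * ‖g' η‖ₑ) := by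
            gcongr
            rw [← ENNReal.ofReal_mul (Real.exp_pos _).le, ← Real.exp_add, ← mul_add]
            exact ENNReal.ofReal_le_ofReal (Real.exp_le_exp.2 (mul_le_mul_of_nonneg_left
              (gevreyExponent_le_sub_add hα hα1 hβ hβ1 ξ η) hτ))
        _ = _ := by ring
    have h2 : ENNReal.ofReal (gevreyWeight α β (s - δ - 1) τ ξ) * ENNReal.ofReal (bracket 1 ξ) =
        ENNReal.ofReal (bracket (s - δ) ξ) *
          ENNReal.ofReal (Real.exp (τ * gevreyExponent α β ξ)) := by
      rw [← ENNReal.ofReal_mul (gevreyWeight_pos _ _ _ _ _).le,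
        ← ENNReal.ofReal_mul (bracket_pos _ _).le, gevreyWeight, mul_right_comm, ← bracket_add]
      simp
    calc _ ≤ ENNReal.ofReal (gevreyWeight α β (s - δ - 1) τ ξ) * (ENNReal.ofReal (bracket 1 ξ) *
          (2 * conv (fun η => ‖hat f η‖ₑ) (fun η => ‖hat g η‖ₑ) ξ)) := by
          gcongr; exact enorm_hatDivFlux_le f g ξ
      _ = 2 * (ENNReal.ofReal (bracket (s - δ) ξ) *
          (ENNReal.ofReal (Real.exp (τ * gevreyExponent α β ξ)) *
            conv (fun η => ‖hat f η‖ₑ) (fun η => ‖hat g η‖ₑ) ξ)) := by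
          rw [← mul_assoc, h2]; ring
      _ ≤ _ := by gcongr
  calc _ ≤ ∫⁻ ξ, 4 * (ENNReal.ofReal (bracket (s - δ) ξ) *
        conv (fun η => ENNReal.ofReal (bracket (-s) η) * (W η * ‖f' η‖ₑ))
          (fun η => ENNReal.ofReal (bracket (-s) η) * (W η * ‖g' η‖ₑ)) ξ) ^ 2 := by
        refine lintegral_mono fun ξ => (pow_le_pow_left' (hpt ξ) 2).trans (le_of_eq ?_)
        rw [mul_pow]; norm_num
    _ ≤ 4 * (productConst s δ * (∫⁻ ξ, (W ξ * ‖f' ξ‖ₑ) ^ 2) * ∫⁻ ξ, (W ξ * ‖g' ξ‖ₑ) ^ 2) := by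
        rw [lintegral_const_mul' _ _ (by finiteness)]
        gcongr
        exact lintegral_bracket_conv_sq_le hs hδ hfm hgm
    _ = _ := by ring

/-! ### The flux depends continuously and bilinearly on its factors -/

theorem hatL1_mul_eq (f g : L2) (ξ : Plane) :
    hatL1 (fun x => f x * g x) ξ =
      Real.Lp.fourierTransformCLM Plane ℂ (mulL1 f g) ((2 * Real.pi)⁻¹ • ξ) :=
  fourier_mul_eq_fourierTransformCLM f g _

theorem hatL1_mul_sub (f f' g g' : L2) (ξ : Plane) :
    hatL1 (fun x => f x * g x) ξ - hatL1 (fun x => f' x * g' x) ξ =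
      hatL1 (fun x => (f - f' : L2) x * g x) ξ + hatL1 (fun x => f' x * (g - g' : L2) x) ξ := by
  simp only [hatL1_mul_eq, mulL1, map_sub, sub_apply,
    BoundedContinuousFunction.sub_apply]
  ring

theorem hatDivFlux_sub (f f' g g' : L2) (ξ : Plane) :
    hatDivFlux f g ξ - hatDivFlux f' g' ξ =
      hatDivFlux (f - f') g ξ + hatDivFlux f' (g - g') ξ := by
  unfold hatDivFlux
  rw [← Finset.sum_sub_distrib, ← Finset.sum_add_distrib]
  refine Finset.sum_congr rfl fun j _ => ?_
  rw [velocity_sub, ← mul_sub, ← mul_add, hatL1_mul_sub]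

theorem continuous_eval_comp_smul {X : Type*} [TopologicalSpace X] (c : ℝ)
    {Ψ : X → BoundedContinuousFunction Plane ℂ} (hΨ : Continuous Ψ) :
    Continuous fun p : X × Plane => Ψ p.1 (c • p.2) := by
  have h4 : Continuous fun p : X × Plane => c • p.2 := continuous_snd.const_smul c
  exact (hΨ.comp continuous_fst).eval h4

theorem continuous_hatL1_mul {X : Type*} [TopologicalSpace X] {f g : X → L2}
    (hf : Continuous f) (hg : Continuous g) :
    Continuous fun p : X × Plane => hatL1 (fun x => f p.1 x * g p.1 x) p.2 := by
  simp only [hatL1_mul_eq]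
  have h1 : Continuous fun x : X => mulL1 (f x) (g x) := by
    have h := continuous_mulL1.comp (hf.prodMk hg)
    exact h
  exact continuous_eval_comp_smul _ ((Real.Lp.fourierTransformCLM Plane ℂ).continuous.comp h1)

theorem continuous_hatDivFlux {X : Type*} [TopologicalSpace X] {f g : X → L2}
    (hf : Continuous f) (hg : Continuous g) :
    Continuous fun p : X × Plane => hatDivFlux (f p.1) (g p.1) p.2 := by
  have h3 : ∀ j : Fin 2, Continuous fun p : X × Plane =>
      hatL1 (fun x => f p.1 x * velocity j (g p.1) x) p.2 :=
    fun j => continuous_hatL1_mul hf ((continuous_velocity j).comp hg)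
  have h1 : ∀ j : Fin 2, Continuous fun p : X × Plane => Complex.I * (p.2 j : ℂ) := by
    intro j
    fun_prop
  exact continuous_finsetSum _ fun j _ => (h1 j).mul (h3 j)

theorem add_sq_le_two_mul (a b : ℝ≥0∞) : (a + b) ^ 2 ≤ 2 * (a ^ 2 + b ^ 2) := by
  have h := ENNReal.rpow_add_le_mul_rpow_add_rpow a b (p := 2) (by norm_num)
  simp only [ENNReal.rpow_two] at h
  norm_num at h
  exact h

theorem lintegral_add_sq_le {F G : Plane → ℝ≥0∞} (hF : AEMeasurable F) :
    ∫⁻ ξ, (F ξ + G ξ) ^ 2 ≤ 2 * ((∫⁻ ξ, F ξ ^ 2) + ∫⁻ ξ, G ξ ^ 2) := by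
  rw [← lintegral_add_left' (hF.pow_const 2), ← lintegral_const_mul' _ _ (by finiteness)]
  exact lintegral_mono fun ξ => add_sq_le_two_mul _ _

/-! ### Parabolic smoothing of time integrals -/

/-- The exponents used in the estimates: `γ ≤ min α β` counts the derivatives controlled by the
dissipation, `δ` is the loss in the product law `H^s · H^s ⊆ H^{s-δ}`, and `a < 1` is the order of
the time singularity which compensates for the `1 + δ` lost derivatives. -/
structure Admissible (α β s γ δ a : ℝ) : Prop where
  γ_nonneg : 0 ≤ γ
  γ_le_α : γ ≤ α
  γ_le_β : γ ≤ β
  α_le_one : α ≤ 1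
  β_le_one : β ≤ 1
  s_nonneg : 0 ≤ s
  δ_nonneg : 0 ≤ δ
  one_lt : 1 < s + δ
  a_nonneg : 0 ≤ a
  a_lt_one : a < 1
  loss : 2 * γ * a = 1 + δ

namespace Admissible

variable {α β s γ δ a : ℝ} (h : Admissible α β s γ δ a)
include h

theorem α_nonneg : 0 ≤ α := h.γ_nonneg.trans h.γ_le_α

theorem β_nonneg : 0 ≤ β := h.γ_nonneg.trans h.γ_le_β

end Admissible

/-- The constant in the smoothing estimate on time intervals of length at most `T`. -/
def smoothingConst (T : ℝ) : ℝ := Real.exp T * (3 + 3 * T)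

/-- The primitive of `σ^{-a}`. -/
def kernelPrimitive (a t : ℝ) : ℝ := t ^ (1 - a) / (1 - a)

/-- The heat semigroup `e^{-σA(D)}` regains the `1 + δ` derivatives lost in the flux and, at the
same time, increases the parameter of the Gevrey weight by `σ`. -/
theorem gevreyWeight_mul_exp_le {α β s γ δ a σ T ρ ρ' : ℝ} (h : Admissible α β s γ δ a)
    (hσ : 0 < σ) (hσT : σ ≤ T) (hρ : ρ ≤ ρ' + σ) (ξ : Plane) :
    gevreyWeight α β s ρ ξ * Real.exp (-(σ * dissipationSymbol α β ξ)) ≤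
      smoothingConst T * σ ^ (-a) * gevreyWeight α β (s - δ - 1) ρ' ξ := by
  have hγ1 : γ ≤ 1 := h.γ_le_α.trans h.α_le_one
  have h1 := bracket_mul_exp_le h.γ_nonneg hγ1 h.γ_le_α h.γ_le_β h.a_nonneg h.a_lt_one.le hσ hσT ξ
  rw [h.loss] at h1
  set A := dissipationSymbol α β ξ with hA
  set L := gevreyExponent α β ξ with hL
  have hL0 : 0 ≤ L := gevreyExponent_nonneg α β ξ
  have hLA : L ≤ 1 + A / 2 := gevreyExponent_le α β ξ
  have h2 : Real.exp (ρ * L) * Real.exp (-(σ * A)) ≤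
      Real.exp (ρ' * L) * (Real.exp T * Real.exp (-(σ * A / 2))) := by
    rw [← Real.exp_add, ← Real.exp_add, ← Real.exp_add]
    refine Real.exp_le_exp.2 ?_
    have h3 : ρ * L ≤ (ρ' + σ) * L := by gcongr
    have h4 : σ * L ≤ σ * (1 + A / 2) := by gcongr
    nlinarith
  have h5 : bracket s ξ = bracket (s - δ - 1) ξ * bracket (1 + δ) ξ := by
    rw [← bracket_add]; congr 1; ring
  have hb1 := bracket_pos (s - δ - 1) ξ
  have hb2 := bracket_pos (1 + δ) ξ
  calc gevreyWeight α β s ρ ξ * Real.exp (-(σ * A))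
      = bracket s ξ * (Real.exp (ρ * L) * Real.exp (-(σ * A))) := by
        rw [gevreyWeight]; ring
    _ ≤ bracket s ξ * (Real.exp (ρ' * L) * (Real.exp T * Real.exp (-(σ * A / 2)))) := by
        have := (bracket_pos s ξ).le
        gcongr
    _ = (bracket (s - δ - 1) ξ * Real.exp (ρ' * L) * Real.exp T) *
          (bracket (1 + δ) ξ * Real.exp (-(σ * A / 2))) := by rw [h5]; ring
    _ ≤ (bracket (s - δ - 1) ξ * Real.exp (ρ' * L) * Real.exp T) * ((3 + 3 * T) * σ ^ (-a)) := by
        gcongr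
    _ = _ := by rw [smoothingConst, gevreyWeight]; ring

theorem lintegral_rpow_neg {a b₀ b₁ : ℝ} (ha1 : a < 1) (hb₀ : 0 ≤ b₀) (hb : b₀ ≤ b₁) {c : ℝ}
    (hc : 0 ≤ c) :
    ∫⁻ σ in Ioc b₀ b₁, ENNReal.ofReal (c * σ ^ (-a)) =
      ENNReal.ofReal (c * (kernelPrimitive a b₁ - kernelPrimitive a b₀)) := by
  have hint : IntervalIntegrable (fun σ : ℝ => σ ^ (-a)) volume b₀ b₁ :=
    intervalIntegral.intervalIntegrable_rpow' (by linarith)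
  rw [← ofReal_integral_eq_lintegral_ofReal]
  · rw [← intervalIntegral.integral_of_le hb, intervalIntegral.integral_const_mul,
      integral_rpow (Or.inl (by linarith))]
    unfold kernelPrimitive
    rw [neg_add_eq_sub, sub_div]
  · exact ((intervalIntegrable_iff_integrableOn_Ioc_of_le hb).1 hint).const_mul c
  · refine (ae_restrict_iff' measurableSet_Ioc).2 (Eventually.of_forall fun σ hσ => ?_)
    have : 0 < σ := hb₀.trans_lt hσ.1
    positivity

/-- The heat semigroup integrates a bounded family in the space of order `s - δ - 1` into `H^s`,
with Gevrey weights. -/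
theorem lintegral_smoothing_sq_le {α β s γ δ a : ℝ} (h : Admissible α β s γ δ a) {b₀ b₁ T : ℝ}
    (hb₀ : 0 ≤ b₀) (hb : b₀ ≤ b₁) (hT : b₁ ≤ T) {D : ℝ → Plane → ℂ}
    (hD : Measurable (Function.uncurry D)) {ρ : ℝ} {ρ' : ℝ → ℝ} (hρ' : Measurable ρ')
    (hρ : ∀ σ ∈ Ioc b₀ b₁, ρ ≤ ρ' σ + σ) {B : ℝ≥0∞}
    (hB : ∀ σ ∈ Ioc b₀ b₁, ∫⁻ ξ, (ENNReal.ofReal (gevreyWeight α β (s - δ - 1) (ρ' σ) ξ) *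
      ‖D σ ξ‖ₑ) ^ 2 ≤ B) :
    ∫⁻ ξ, (ENNReal.ofReal (gevreyWeight α β s ρ ξ) *
      ‖∫ σ in b₀..b₁, (Real.exp (-(σ * dissipationSymbol α β ξ)) : ℂ) * D σ ξ‖ₑ) ^ 2 ≤
      ENNReal.ofReal (smoothingConst T * (kernelPrimitive a b₁ - kernelPrimitive a b₀)) ^ 2 *
        B := by
  have hT0 : 0 ≤ T := hb₀.trans (hb.trans hT)
  have hc : 0 ≤ smoothingConst T := by unfold smoothingConst; positivity
  obtain ⟨k, hk⟩ : ∃ k : ℝ → ℝ≥0∞, k = fun σ => ENNReal.ofReal (smoothingConst T * σ ^ (-a)) :=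
    ⟨_, rfl⟩
  have hkm : Measurable k := by rw [hk]; fun_prop
  obtain ⟨H, hH⟩ : ∃ H : ℝ → Plane → ℝ≥0∞, H = fun σ ξ =>
    ENNReal.ofReal (gevreyWeight α β (s - δ - 1) (ρ' σ) ξ) * ‖D σ ξ‖ₑ := ⟨_, rfl⟩
  have hHm : Measurable (Function.uncurry H) := by
    rw [hH]
    refine Measurable.mul ?_ hD.enorm
    refine Measurable.ennreal_ofReal ?_
    unfold gevreyWeight
    exact ((continuous_bracket _).measurable.comp measurable_snd).mul
      ((hρ'.comp measurable_fst).mul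
        ((continuous_gevreyExponent h.α_nonneg h.β_nonneg).measurable.comp measurable_snd)).exp
  have hBν : ∀ᵐ σ ∂(volume.restrict (Ioc b₀ b₁)).withDensity k, ∫⁻ ξ, H σ ξ ^ 2 ≤ B :=
    (withDensity_absolutelyContinuous _ _).ae_le
      ((ae_restrict_iff' measurableSet_Ioc).2 (Eventually.of_forall (by rw [hH]; exact hB)))
  have hmain := lintegral_lintegral_sq_le (μ := (volume : Measure Plane)) hHm hBν
  rw [withDensity_apply _ MeasurableSet.univ, Measure.restrict_univ, hk,
    lintegral_rpow_neg h.a_lt_one hb₀ hb hc, ← hk] at hmain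
  refine le_trans (lintegral_mono fun ξ => ?_) hmain
  refine pow_le_pow_left' ?_ 2
  have hHξ : Measurable fun σ => H σ ξ := hHm.comp measurable_prodMk_right
  rw [lintegral_withDensity_eq_lintegral_mul _ hkm hHξ, intervalIntegral.integral_of_le hb]
  calc _ ≤ ENNReal.ofReal (gevreyWeight α β s ρ ξ) * ∫⁻ σ in Ioc b₀ b₁,
        ‖(Real.exp (-(σ * dissipationSymbol α β ξ)) : ℂ) * D σ ξ‖ₑ := by
        gcongr; exact enorm_integral_le_lintegral_enorm _
    _ = ∫⁻ σ in Ioc b₀ b₁, ENNReal.ofReal (gevreyWeight α β s ρ ξ) *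
        ‖(Real.exp (-(σ * dissipationSymbol α β ξ)) : ℂ) * D σ ξ‖ₑ :=
        (lintegral_const_mul' _ _ ENNReal.ofReal_ne_top).symm
    _ ≤ _ := by
        refine setLIntegral_mono' measurableSet_Ioc fun σ hσ => ?_
        have hσ0 : 0 < σ := hb₀.trans_lt hσ.1
        have hle := ENNReal.ofReal_le_ofReal
          (gevreyWeight_mul_exp_le h hσ0 (hσ.2.trans hT) (hρ σ hσ) ξ)
        rw [ENNReal.ofReal_mul (gevreyWeight_pos _ _ _ _ _).le,
          ENNReal.ofReal_mul (by positivity)] at hle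
        rw [enorm_mul, ← ofReal_norm (Real.exp _ : ℂ), Complex.norm_real,
          Real.norm_of_nonneg (Real.exp_pos _).le, ← mul_assoc, Pi.mul_apply, hH, hk, ← mul_assoc]
        exact mul_le_mul_left hle _

/-! ### The Duhamel term -/

/-- The Fourier transform of `∫₀ᵗ e^{-(t-τ)A(D)} div (θ u_θ)(τ) dτ`. -/
def duhamelTerm (α β : ℝ) (θ : ℝ → L2) (t : ℝ) (ξ : Plane) : ℂ :=
  ∫ τ in (0 : ℝ)..t, (Real.exp (-((t - τ) * dissipationSymbol α β ξ)) : ℂ) *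
    hatDivFlux (θ τ) (θ τ) ξ

/-- The form with the elapsed time `σ = t - τ` as variable, in which the heat kernel does not depend
on `t`. -/
theorem duhamelTerm_eq (α β : ℝ) (θ : ℝ → L2) (t : ℝ) (ξ : Plane) :
    duhamelTerm α β θ t ξ = ∫ σ in (0 : ℝ)..t, (Real.exp (-(σ * dissipationSymbol α β ξ)) : ℂ) *
      hatDivFlux (θ (t - σ)) (θ (t - σ)) ξ := by
  have h := intervalIntegral.integral_comp_sub_left (a := 0) (b := t)
    (fun σ => (Real.exp (-(σ * dissipationSymbol α β ξ)) : ℂ) *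
      hatDivFlux (θ (t - σ)) (θ (t - σ)) ξ) t
  simp only [sub_sub_cancel, sub_self, sub_zero] at h
  exact h

theorem duhamelTerm_congr (α β : ℝ) {θ θ' : ℝ → L2} {t : ℝ} (ht : 0 ≤ t)
    (h : ∀ τ ∈ Icc 0 t, θ τ = θ' τ) (ξ : Plane) :
    duhamelTerm α β θ t ξ = duhamelTerm α β θ' t ξ := by
  refine intervalIntegral.integral_congr fun τ hτ => ?_
  rw [uIcc_of_le ht] at hτ
  simp only [h τ hτ]

theorem continuous_flux {θ : ℝ → L2} (hθ : Continuous θ) (t : ℝ) :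
    Continuous fun p : ℝ × Plane => hatDivFlux (θ (t - p.1)) (θ (t - p.1)) p.2 := by
  have h0 : Continuous fun σ : ℝ => t - σ := continuous_const.sub continuous_id
  have h := continuous_hatDivFlux (hθ.comp h0) (hθ.comp h0)
  exact h

theorem continuous_duhamel_integrand (α β : ℝ) {θ : ℝ → L2} (hθ : Continuous θ) (t : ℝ)
    (ξ : Plane) :
    Continuous fun σ : ℝ => (Real.exp (-(σ * dissipationSymbol α β ξ)) : ℂ) *
      hatDivFlux (θ (t - σ)) (θ (t - σ)) ξ := by
  have h1 : Continuous fun σ : ℝ => hatDivFlux (θ (t - σ)) (θ (t - σ)) ξ :=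
    (continuous_flux hθ t).comp (continuous_id.prodMk continuous_const)
  refine Continuous.mul ?_ h1
  fun_prop

theorem stronglyMeasurable_duhamelTerm {α β : ℝ} (hα : 0 ≤ α) (hβ : 0 ≤ β) {θ : ℝ → L2}
    (hθ : Continuous θ) {t : ℝ} (ht : 0 ≤ t) :
    StronglyMeasurable (duhamelTerm α β θ t) := by
  have h1 : Continuous fun p : Plane × ℝ =>
      (Real.exp (-(p.2 * dissipationSymbol α β p.1)) : ℂ) *
        hatDivFlux (θ (t - p.2)) (θ (t - p.2)) p.1 := by
    have h2 : Continuous fun p : Plane × ℝ => hatDivFlux (θ (t - p.2)) (θ (t - p.2)) p.1 :=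
      (continuous_flux hθ t).comp continuous_swap
    have h3 := (continuous_dissipationSymbol hα hβ).comp (continuous_fst (X := Plane) (Y := ℝ))
    refine Continuous.mul ?_ h2
    exact Complex.continuous_ofReal.comp (Real.continuous_exp.comp (continuous_snd.mul h3).neg)
  have h4 := h1.stronglyMeasurable.integral_prod_right' (ν := volume.restrict (Ioc 0 t))
  have h5 : duhamelTerm α β θ t = fun ξ => ∫ σ in Ioc 0 t,
      (Real.exp (-(σ * dissipationSymbol α β ξ)) : ℂ) *
        hatDivFlux (θ (t - σ)) (θ (t - σ)) ξ := by
    funext ξ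
    rw [duhamelTerm_eq, intervalIntegral.integral_of_le ht]
  rw [h5]
  exact h4

theorem kernelPrimitive_zero {a : ℝ} (ha : a < 1) : kernelPrimitive a 0 = 0 := by
  rw [kernelPrimitive, Real.zero_rpow (by linarith), zero_div]

/-- The flux is locally Lipschitz, with a loss of `1 + δ` derivatives. -/
theorem lintegral_hatDivFlux_sub_sq_le {α β s γ δ a : ℝ} (h : Admissible α β s γ δ a) {τ : ℝ}
    (hτ : 0 ≤ τ) {f g : L2} {M Y : ℝ≥0∞} (hf : gevreyEnergy α β s τ f ≤ M)
    (hg : gevreyEnergy α β s τ g ≤ M) (hY : gevreyEnergy α β s τ (f - g) ≤ Y) :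
    ∫⁻ ξ, (ENNReal.ofReal (gevreyWeight α β (s - δ - 1) τ ξ) *
      ‖hatDivFlux f f ξ - hatDivFlux g g ξ‖ₑ) ^ 2 ≤ 16 * productConst s δ * M * Y := by
  set W : Plane → ℝ≥0∞ := fun ξ => ENNReal.ofReal (gevreyWeight α β (s - δ - 1) τ ξ) with hW
  have hWm : Measurable W := (measurable_gevreyWeight h.α_nonneg h.β_nonneg _ τ).ennreal_ofReal
  have hcont : ∀ f g : L2, Continuous fun ξ => hatDivFlux f g ξ := fun f g =>
    (continuous_hatDivFlux (X := Unit) (f := fun _ => f) (g := fun _ => g) continuous_const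
      continuous_const).comp (Continuous.prodMk_right ())
  have hb := fun f g : L2 => lintegral_hatDivFlux_sq_le (δ := δ) h.α_nonneg h.α_le_one h.β_nonneg
    h.β_le_one h.s_nonneg h.δ_nonneg hτ f g
  calc _ ≤ ∫⁻ ξ, (W ξ * ‖hatDivFlux (f - g) f ξ‖ₑ + W ξ * ‖hatDivFlux g (f - g) ξ‖ₑ) ^ 2 := by
        refine lintegral_mono fun ξ => ?_
        rw [hatDivFlux_sub, ← mul_add]
        gcongr
        exact enorm_add_le _ _
    _ ≤ 2 * ((∫⁻ ξ, (W ξ * ‖hatDivFlux (f - g) f ξ‖ₑ) ^ 2) +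
          ∫⁻ ξ, (W ξ * ‖hatDivFlux g (f - g) ξ‖ₑ) ^ 2) :=
        lintegral_add_sq_le (hWm.mul (hcont _ _).measurable.enorm).aemeasurable
    _ ≤ 2 * (4 * productConst s δ * Y * M + 4 * productConst s δ * M * Y) := by
        gcongr
        · exact (hb _ _).trans (by gcongr)
        · exact (hb _ _).trans (by gcongr)
    _ = _ := by ring

/-- The bound on the Duhamel term, with the growing Gevrey weight for `l = 1` and without it for
`l = 0`. -/
theorem lintegral_duhamelTerm_sq_le {α β s γ δ a : ℝ} (h : Admissible α β s γ δ a) {t T l : ℝ}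
    (ht : 0 ≤ t) (htT : t ≤ T) (hl : 0 ≤ l) (hl1 : l ≤ 1) {θ : ℝ → L2} (hθ : Continuous θ)
    {M : ℝ≥0∞} (hM : ∀ τ ∈ Icc 0 t, gevreyEnergy α β s (l * τ) (θ τ) ≤ M) :
    ∫⁻ ξ, (ENNReal.ofReal (gevreyWeight α β s (l * t) ξ) * ‖duhamelTerm α β θ t ξ‖ₑ) ^ 2 ≤
      ENNReal.ofReal (smoothingConst T * kernelPrimitive a t) ^ 2 *
        (4 * productConst s δ * M * M) := by
  simp only [duhamelTerm_eq]
  have key := lintegral_smoothing_sq_le h le_rfl ht htT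
    (D := fun σ ξ => hatDivFlux (θ (t - σ)) (θ (t - σ)) ξ) (continuous_flux hθ t).measurable
    (ρ := l * t) (ρ' := fun σ => l * (t - σ)) (by fun_prop)
    (fun σ hσ => by nlinarith [hσ.1]) (B := 4 * productConst s δ * M * M) (fun σ hσ => by
      have hm : t - σ ∈ Icc 0 t := ⟨by linarith [hσ.2], by linarith [hσ.1]⟩
      refine (lintegral_hatDivFlux_sq_le h.α_nonneg h.α_le_one h.β_nonneg
        h.β_le_one h.s_nonneg h.δ_nonneg (mul_nonneg hl hm.1) _ _).trans ?_
      have := hM _ hm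
      gcongr)
  rwa [kernelPrimitive_zero h.a_lt_one, sub_zero] at key

/-- The Duhamel terms of two paths which agree up to time `t - b` differ by a time integral over an
interval of length `b`. -/
theorem lintegral_duhamelTerm_sub_sq_le {α β s γ δ a : ℝ} (h : Admissible α β s γ δ a)
    {t b T : ℝ} (hb : 0 ≤ b) (hbt : b ≤ t) (htT : t ≤ T) {θ θ' : ℝ → L2} (hθ : Continuous θ)
    (hθ' : Continuous θ') {M Y : ℝ≥0∞} (hM : ∀ τ ∈ Icc 0 t, gevreyEnergy α β s 0 (θ τ) ≤ M)
    (hM' : ∀ τ ∈ Icc 0 t, gevreyEnergy α β s 0 (θ' τ) ≤ M)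
    (hY : ∀ τ ∈ Icc 0 t, gevreyEnergy α β s 0 (θ τ - θ' τ) ≤ Y)
    (heq : ∀ τ, 0 ≤ τ → τ < t - b → θ τ = θ' τ) :
    ∫⁻ ξ, (ENNReal.ofReal (gevreyWeight α β s 0 ξ) *
        ‖duhamelTerm α β θ t ξ - duhamelTerm α β θ' t ξ‖ₑ) ^ 2 ≤
      ENNReal.ofReal (smoothingConst T * kernelPrimitive a b) ^ 2 *
        (16 * productConst s δ * M * Y) := by
  have hint : ∀ (ξ : Plane) (c d : ℝ), IntervalIntegrable (fun σ : ℝ =>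
      (Real.exp (-(σ * dissipationSymbol α β ξ)) : ℂ) * (hatDivFlux (θ (t - σ)) (θ (t - σ)) ξ -
        hatDivFlux (θ' (t - σ)) (θ' (t - σ)) ξ)) volume c d := by
    intro ξ c d
    simp only [mul_sub]
    exact ((continuous_duhamel_integrand α β hθ t ξ).sub
      (continuous_duhamel_integrand α β hθ' t ξ)).intervalIntegrable _ _
  have hdiff : ∀ ξ, duhamelTerm α β θ t ξ - duhamelTerm α β θ' t ξ =
      ∫ σ in (0 : ℝ)..b, (Real.exp (-(σ * dissipationSymbol α β ξ)) : ℂ) *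
        (hatDivFlux (θ (t - σ)) (θ (t - σ)) ξ - hatDivFlux (θ' (t - σ)) (θ' (t - σ)) ξ) := by
    intro ξ
    rw [duhamelTerm_eq, duhamelTerm_eq, ← intervalIntegral.integral_sub
      ((continuous_duhamel_integrand α β hθ t ξ).intervalIntegrable _ _)
      ((continuous_duhamel_integrand α β hθ' t ξ).intervalIntegrable _ _)]
    simp only [← mul_sub]
    rw [← intervalIntegral.integral_add_adjacent_intervals (hint ξ 0 b) (hint ξ b t),
      add_eq_left]
    refine intervalIntegral.integral_zero_ae (Eventually.of_forall fun σ hσ => ?_)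
    rw [uIoc_of_le hbt] at hσ
    rw [heq (t - σ) (by linarith [hσ.2]) (by linarith [hσ.1]), sub_self, mul_zero]
  simp only [hdiff]
  have key := lintegral_smoothing_sq_le h le_rfl hb (hbt.trans htT)
    (D := fun σ ξ => hatDivFlux (θ (t - σ)) (θ (t - σ)) ξ - hatDivFlux (θ' (t - σ)) (θ' (t - σ)) ξ)
    ((continuous_flux hθ t).sub (continuous_flux hθ' t)).measurable
    (ρ := 0) (ρ' := fun _ => 0) measurable_const
    (fun σ hσ => by linarith [hσ.1]) (B := 16 * productConst s δ * M * Y) (fun σ hσ => by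
      have hm : t - σ ∈ Icc 0 t := ⟨by linarith [hσ.2], by linarith [hσ.1]⟩
      exact lintegral_hatDivFlux_sub_sq_le h le_rfl (hM _ hm) (hM' _ hm) (hY _ hm))
  rwa [kernelPrimitive_zero h.a_lt_one, sub_zero] at key

/-- The modulus of continuity in time of the Duhamel term. Writing the integral in the elapsed time,
the increment is the difference of the Duhamel terms at time `t` of `θ` shifted by `t' - t` and of
`θ`, plus an integral over `[t, t']`. -/
theorem lintegral_duhamelTerm_time_sub_sq_le {α β s γ δ a : ℝ} (h : Admissible α β s γ δ a)
    {t t' T : ℝ} (ht : 0 ≤ t) (htt' : t ≤ t') (htT : t' ≤ T) {θ : ℝ → L2} (hθ : Continuous θ)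
    {M Y : ℝ≥0∞} (hM : ∀ τ ∈ Icc 0 t', gevreyEnergy α β s 0 (θ τ) ≤ M)
    (hY : ∀ τ ∈ Icc 0 t, gevreyEnergy α β s 0 (θ (t' - t + τ) - θ τ) ≤ Y) :
    ∫⁻ ξ, (ENNReal.ofReal (gevreyWeight α β s 0 ξ) *
        ‖duhamelTerm α β θ t' ξ - duhamelTerm α β θ t ξ‖ₑ) ^ 2 ≤
      2 * (ENNReal.ofReal (smoothingConst T * kernelPrimitive a t) ^ 2 *
        (16 * productConst s δ * M * Y) +
        ENNReal.ofReal (smoothingConst T * (kernelPrimitive a t' - kernelPrimitive a t)) ^ 2 *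
        (4 * productConst s δ * M * M)) := by
  have hi := fun ξ => continuous_duhamel_integrand α β hθ t' ξ
  have hθs : Continuous fun τ => θ (t' - t + τ) := hθ.comp (by fun_prop)
  have hsplit : ∀ ξ, duhamelTerm α β θ t' ξ - duhamelTerm α β θ t ξ =
      (duhamelTerm α β (fun τ => θ (t' - t + τ)) t ξ - duhamelTerm α β θ t ξ) +
      ∫ σ in t..t', (Real.exp (-(σ * dissipationSymbol α β ξ)) : ℂ) *
        hatDivFlux (θ (t' - σ)) (θ (t' - σ)) ξ := by
    intro ξ
    rw [duhamelTerm_eq α β θ t', duhamelTerm_eq α β (fun τ => θ (t' - t + τ)),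
      ← intervalIntegral.integral_add_adjacent_intervals ((hi ξ).intervalIntegrable 0 t)
      ((hi ξ).intervalIntegrable t t')]
    simp only [sub_add_sub_cancel]
    ring
  have h1 := lintegral_duhamelTerm_sub_sq_le h ht le_rfl (htt'.trans htT) hθs hθ
    (fun τ hτ => hM _ ⟨by linarith [hτ.1], by linarith [hτ.2]⟩)
    (fun τ hτ => hM _ ⟨hτ.1, hτ.2.trans htt'⟩) hY (fun τ h0 h1 => by linarith)
  have h2 := lintegral_smoothing_sq_le h ht htt' htT
    (D := fun σ ξ => hatDivFlux (θ (t' - σ)) (θ (t' - σ)) ξ) (continuous_flux hθ t').measurable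
    (ρ := 0) (ρ' := fun _ => 0) measurable_const
    (fun σ hσ => by linarith [hσ.1]) (B := 4 * productConst s δ * M * M) (fun σ hσ => by
      have hm : t' - σ ∈ Icc 0 t' := ⟨by linarith [hσ.2], by linarith [hσ.1]⟩
      refine (lintegral_hatDivFlux_sq_le h.α_nonneg h.α_le_one h.β_nonneg
        h.β_le_one h.s_nonneg h.δ_nonneg le_rfl _ _).trans ?_
      have := hM _ hm
      gcongr)
  have hWm : Measurable fun ξ => ENNReal.ofReal (gevreyWeight α β s 0 ξ) :=
    (measurable_gevreyWeight h.α_nonneg h.β_nonneg s 0).ennreal_ofReal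
  have hm1 := ((stronglyMeasurable_duhamelTerm h.α_nonneg h.β_nonneg hθs ht).sub
    (stronglyMeasurable_duhamelTerm h.α_nonneg h.β_nonneg hθ ht)).enorm
  refine le_trans ?_ (mul_le_mul_right (add_le_add h1 h2) 2)
  refine le_trans (lintegral_mono fun ξ => ?_)
    (lintegral_add_sq_le (hWm.mul hm1).aemeasurable)
  rw [hsplit, ← mul_add]
  gcongr
  exact enorm_add_le _ _

/-! ### Convergence in `H^s` and truncated Gevrey multipliers -/

theorem Hs.enorm_sq_of_hat_eq {s : ℝ} {f : Hs s} {F : Plane → ℂ} (h : hat f.toL2 =ᵐ[volume] F) :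
    ‖f‖ₑ ^ 2 = ∫⁻ ξ, (ENNReal.ofReal (bracket s ξ) * ‖F ξ‖ₑ) ^ 2 := by
  rw [Hs.enorm_sq]
  exact lintegral_congr_ae (h.mono fun ξ hξ => by simp only [hξ])

theorem Hs.hat_sub {s : ℝ} {f g : Hs s} {F G : Plane → ℂ} (hf : hat f.toL2 =ᵐ[volume] F)
    (hg : hat g.toL2 =ᵐ[volume] G) : hat (f - g).toL2 =ᵐ[volume] fun ξ => F ξ - G ξ := by
  rw [Hs.toL2_sub]
  filter_upwards [AQG.hat_sub f.toL2 g.toL2, hf, hg] with ξ h1 h2 h3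
  rw [h1, Pi.sub_apply, h2, h3]

theorem Hs.norm_le_of_hat_le {s c : ℝ} (hc : 0 ≤ c) {f g : Hs s}
    (h : ∀ᵐ ξ, ‖hat f.toL2 ξ‖ ≤ c * ‖hat g.toL2 ξ‖) : ‖f‖ ≤ c * ‖g‖ := by
  have h1 : ‖f‖ₑ ^ 2 ≤ (ENNReal.ofReal c * ‖g‖ₑ) ^ 2 := by
    rw [mul_pow, Hs.enorm_sq, Hs.enorm_sq, ← lintegral_const_mul' _ _ (by finiteness)]
    refine lintegral_mono_ae (h.mono fun ξ hξ => ?_)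
    rw [← mul_pow]
    refine pow_le_pow_left' ?_ 2
    rw [mul_left_comm]
    refine mul_le_mul_right ?_ _
    rw [← ofReal_norm, ← ofReal_norm, ← ENNReal.ofReal_mul hc]
    exact ENNReal.ofReal_le_ofReal hξ
  have h2 := (ENNReal.pow_le_pow_left_iff two_ne_zero).1 h1
  rw [← ofReal_norm, ← ofReal_norm, ← ENNReal.ofReal_mul hc] at h2
  exact (ENNReal.ofReal_le_ofReal_iff (by positivity)).1 h2

theorem tendsto_zero_of_sq_tendsto_zero {ι : Type*} {l : Filter ι} {u : ι → ℝ≥0∞}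
    (h : Tendsto (fun i => u i ^ 2) l (𝓝 0)) : Tendsto u l (𝓝 0) := by
  have h1 := (ENNReal.continuous_rpow_const (y := (1 / 2 : ℝ))).tendsto 0 |>.comp h
  simp only [Function.comp_def, ← ENNReal.rpow_two, ← ENNReal.rpow_mul] at h1
  norm_num at h1
  exact h1

/-- Dominated convergence in `H^s`. -/
theorem Hs.tendsto_of_dominated {ι : Type*} {l : Filter ι} [l.IsCountablyGenerated] {s : ℝ}
    {f : ι → Hs s} {g : Hs s} {F : ι → Plane → ℂ} {G : Plane → ℂ}
    (hf : ∀ i, hat (f i).toL2 =ᵐ[volume] F i) (hg : hat g.toL2 =ᵐ[volume] G)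
    {bound : Plane → ℝ≥0∞}
    (hb : ∀ i ξ, ENNReal.ofReal (bracket s ξ) * ‖F i ξ - G ξ‖ₑ ≤ bound ξ)
    (hb' : ∫⁻ ξ, bound ξ ^ 2 ≠ ∞) (hlim : ∀ ξ, Tendsto (fun i => F i ξ) l (𝓝 (G ξ))) :
    Tendsto f l (𝓝 g) := by
  rw [tendsto_iff_edist_tendsto_0]
  refine tendsto_zero_of_sq_tendsto_zero ?_
  have h1 : ∀ i, edist (f i) g ^ 2 =
      ∫⁻ ξ, (ENNReal.ofReal (bracket s ξ) * ‖F i ξ - G ξ‖ₑ) ^ 2 := fun i => by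
    rw [edist_eq_enorm_sub, Hs.enorm_sq_of_hat_eq (Hs.hat_sub (hf i) hg)]
  simp only [h1]
  have h0 : ∫⁻ _ : Plane, (0 : ℝ≥0∞) = 0 := by simp
  rw [← h0]
  refine tendsto_lintegral_filter_of_dominated_convergence' (fun ξ => bound ξ ^ 2)
    (Eventually.of_forall fun i => ?_)
    (Eventually.of_forall fun i => Eventually.of_forall fun ξ => pow_le_pow_left' (hb i ξ) 2) hb'
    (Eventually.of_forall fun ξ => ?_)
  · refine AEMeasurable.pow_const ?_ 2
    refine (measurable_ofReal_bracket s).aemeasurable.mul ?_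
    exact (((aestronglyMeasurable_hat _).congr (hf i)).sub
      ((aestronglyMeasurable_hat _).congr hg)).enorm
  · have h2 : Tendsto (fun i => ‖F i ξ - G ξ‖ₑ) l (𝓝 0) := by
      have := ((hlim ξ).sub_const (G ξ)).enorm
      simpa using this
    have h3 := ENNReal.Tendsto.const_mul h2
      (Or.inr (ENNReal.ofReal_ne_top (r := bracket s ξ)))
    have h4 := ((ENNReal.continuous_pow 2).tendsto _).comp h3
    simpa [Function.comp_def] using h4

theorem Hs.enorm_sq_eq_gevreyWeight {s : ℝ} (α β : ℝ) {f : Hs s} {F : Plane → ℂ}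
    (h : hat f.toL2 =ᵐ[volume] F) :
    ‖f‖ₑ ^ 2 = ∫⁻ ξ, (ENNReal.ofReal (gevreyWeight α β s 0 ξ) * ‖F ξ‖ₑ) ^ 2 := by
  rw [Hs.enorm_sq_of_hat_eq h]
  simp [gevreyWeight]

theorem gevreyEnergy_mono {α β s τ τ' : ℝ} (h : τ ≤ τ') (f : L2) :
    gevreyEnergy α β s τ f ≤ gevreyEnergy α β s τ' f := by
  refine lintegral_mono fun ξ => ?_
  have h1 : gevreyWeight α β s τ ξ ≤ gevreyWeight α β s τ' ξ := by
    unfold gevreyWeight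
    have := gevreyExponent_nonneg α β ξ
    have := (bracket_pos s ξ).le
    gcongr
  gcongr

section Truncation

variable {α β s : ℝ} (hs : 0 ≤ s) (hα : 0 ≤ α) (hβ : 0 ≤ β)

/-- The truncation of `|ξ₁|^α + |ξ₂|^β` at height `n`. -/
def truncExponent (α β : ℝ) (n : ℕ) (ξ : Plane) : ℝ := min (gevreyExponent α β ξ) n

theorem truncExponent_nonneg (α β : ℝ) (n : ℕ) (ξ : Plane) : 0 ≤ truncExponent α β n ξ :=
  le_min (gevreyExponent_nonneg α β ξ) (Nat.cast_nonneg n)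

include hs hα hβ in
theorem exists_truncGevrey (n : ℕ) (t : ℝ) (f : Hs s) :
    ∃ g : Hs s, hat g.toL2 =ᵐ[volume] fun ξ =>
      (Real.exp (t * truncExponent α β n ξ) : ℂ) * hat f.toL2 ξ := by
  refine Hs.exists_hat_eq hs ?_ ?_
  · refine AEStronglyMeasurable.mul ?_ (aestronglyMeasurable_hat _)
    have h1 : Continuous (truncExponent α β n) :=
      (continuous_gevreyExponent hα hβ).min continuous_const
    exact (Complex.continuous_ofReal.comp
      (Real.continuous_exp.comp (h1.const_smul t))).aestronglyMeasurable
  · have h2 : ∫⁻ ξ, (ENNReal.ofReal (Real.exp (|t| * n)) *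
        (ENNReal.ofReal (bracket s ξ) * ‖hat f.toL2 ξ‖ₑ)) ^ 2 < ∞ := by
      simp only [mul_pow (ENNReal.ofReal (Real.exp (|t| * n)))]
      rw [lintegral_const_mul' _ _ (by finiteness), ← Hs.enorm_sq]
      exact ENNReal.mul_lt_top (by finiteness) (ENNReal.pow_lt_top (enorm_lt_top))
    refine lt_of_le_of_lt (lintegral_mono fun ξ => ?_) h2
    refine pow_le_pow_left' ?_ 2
    rw [enorm_mul, mul_left_comm]
    refine mul_le_mul_left ?_ _
    rw [← ofReal_norm, Complex.norm_real, Real.norm_of_nonneg (Real.exp_pos _).le]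
    refine ENNReal.ofReal_le_ofReal (Real.exp_le_exp.2 ?_)
    have h3 := truncExponent_nonneg α β n ξ
    have h4 : truncExponent α β n ξ ≤ n := min_le_right _ _
    calc t * truncExponent α β n ξ ≤ |t| * truncExponent α β n ξ := by gcongr; exact le_abs_self t
      _ ≤ _ := by gcongr

/-- The bounded multiplier obtained from `e^{t(|∂₁|^α + |∂₂|^β)}` by truncating the exponent. -/
def truncGevrey (n : ℕ) (t : ℝ) (f : Hs s) : Hs s := (exists_truncGevrey hs hα hβ n t f).choose

theorem hat_truncGevrey (n : ℕ) (t : ℝ) (f : Hs s) :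
    hat (truncGevrey hs hα hβ n t f).toL2 =ᵐ[volume] fun ξ =>
      (Real.exp (t * truncExponent α β n ξ) : ℂ) * hat f.toL2 ξ :=
  (exists_truncGevrey hs hα hβ n t f).choose_spec

theorem abs_exp_mul_sub_exp_mul_le {t t₀ m n : ℝ} (hm : 0 ≤ m) (hmn : m ≤ n) :
    |Real.exp (t * m) - Real.exp (t₀ * m)| ≤
      Real.exp (|t₀| * n) * (Real.exp (|t - t₀| * n) - 1) := by
  have h1 : Real.exp (t * m) - Real.exp (t₀ * m) =
      Real.exp (t₀ * m) * (Real.exp ((t - t₀) * m) - 1) := by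
    rw [mul_sub, ← Real.exp_add, mul_one]; ring_nf
  have h2 : |(t - t₀) * m| ≤ |t - t₀| * n := by
    rw [abs_mul, abs_of_nonneg hm]; gcongr
  have h3 : |Real.exp ((t - t₀) * m) - 1| ≤ Real.exp (|t - t₀| * n) - 1 := by
    have h5 := Real.exp_le_exp.2 h2
    have h6 : Real.exp ((t - t₀) * m) ≤ Real.exp |(t - t₀) * m| := Real.exp_le_exp.2 (le_abs_self _)
    have h7 := Real.add_one_le_exp ((t - t₀) * m)
    have h8 := Real.add_one_le_exp |(t - t₀) * m|
    refine abs_le.2 ⟨?_, by linarith⟩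
    linarith [neg_abs_le ((t - t₀) * m)]
  have h4 : t₀ * m ≤ |t₀| * n := by
    calc t₀ * m ≤ |t₀| * m := by gcongr; exact le_abs_self _
      _ ≤ _ := by gcongr
  rw [h1, abs_mul, abs_of_pos (Real.exp_pos _)]
  gcongr

theorem norm_truncGevrey_sub_le (n : ℕ) (t t₀ : ℝ) (f f₀ : Hs s) :
    ‖truncGevrey hs hα hβ n t f - truncGevrey hs hα hβ n t₀ f₀‖ ≤
      Real.exp (|t| * n) * ‖f - f₀‖ +
        Real.exp (|t₀| * n) * (Real.exp (|t - t₀| * n) - 1) * ‖f₀‖ := by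
  have hf := hat_truncGevrey hs hα hβ n t f
  have hf₀ := hat_truncGevrey hs hα hβ n t f₀
  have hf₀' := hat_truncGevrey hs hα hβ n t₀ f₀
  have h1 : ‖truncGevrey hs hα hβ n t f - truncGevrey hs hα hβ n t f₀‖ ≤
      Real.exp (|t| * n) * ‖f - f₀‖ := by
    refine Hs.norm_le_of_hat_le (Real.exp_pos _).le ?_
    filter_upwards [Hs.hat_sub hf hf₀, Hs.hat_sub (f := f) (g := f₀) (ae_eq_refl _) (ae_eq_refl _)]
      with ξ h1 h2
    rw [h1, h2, ← mul_sub, norm_mul, Complex.norm_real, Real.norm_of_nonneg (Real.exp_pos _).le]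
    have h3 := truncExponent_nonneg α β n ξ
    have h4 : truncExponent α β n ξ ≤ n := min_le_right _ _
    have h5 : t * truncExponent α β n ξ ≤ |t| * n := by
      calc t * truncExponent α β n ξ ≤ |t| * truncExponent α β n ξ := by
            gcongr; exact le_abs_self t
        _ ≤ _ := by gcongr
    gcongr
  have h2 : ‖truncGevrey hs hα hβ n t f₀ - truncGevrey hs hα hβ n t₀ f₀‖ ≤
      Real.exp (|t₀| * n) * (Real.exp (|t - t₀| * n) - 1) * ‖f₀‖ := by
    refine Hs.norm_le_of_hat_le (mul_nonneg (Real.exp_pos _).le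
      (sub_nonneg.2 (Real.one_le_exp (by positivity)))) ?_
    filter_upwards [Hs.hat_sub hf₀ hf₀'] with ξ h1
    rw [h1, ← sub_mul, norm_mul, ← Complex.ofReal_sub, Complex.norm_real, Real.norm_eq_abs]
    gcongr
    exact abs_exp_mul_sub_exp_mul_le (truncExponent_nonneg α β n ξ) (min_le_right _ _)
  calc _ = ‖(truncGevrey hs hα hβ n t f - truncGevrey hs hα hβ n t f₀) +
        (truncGevrey hs hα hβ n t f₀ - truncGevrey hs hα hβ n t₀ f₀)‖ := by rw [sub_add_sub_cancel]
    _ ≤ _ := (norm_add_le _ _).trans (add_le_add h1 h2)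

theorem continuous_truncGevrey (n : ℕ) :
    Continuous fun p : ℝ × Hs s => truncGevrey hs hα hβ n p.1 p.2 := by
  refine continuous_iff_continuousAt.2 fun p₀ => ?_
  refine tendsto_iff_norm_sub_tendsto_zero.2 ?_
  refine squeeze_zero (fun _ => norm_nonneg _)
    (fun p => norm_truncGevrey_sub_le hs hα hβ n p.1 p₀.1 p.2 p₀.2) ?_
  have hc : Continuous fun p : ℝ × Hs s => Real.exp (|p.1| * n) * ‖p.2 - p₀.2‖ +
      Real.exp (|p₀.1| * n) * (Real.exp (|p.1 - p₀.1| * n) - 1) * ‖p₀.2‖ := by fun_prop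
  have := hc.tendsto p₀
  simpa using this

theorem truncExponent_mono (ξ : Plane) : Monotone fun n => truncExponent α β n ξ :=
  fun _ _ h => min_le_min_left _ (Nat.cast_le.2 h)

theorem eventually_truncExponent_eq (ξ : Plane) :
    ∀ᶠ n : ℕ in atTop, truncExponent α β n ξ = gevreyExponent α β ξ := by
  filter_upwards [eventually_ge_atTop ⌈gevreyExponent α β ξ⌉₊] with n hn
  exact min_eq_left ((Nat.le_ceil _).trans (Nat.cast_le.2 hn))

theorem enorm_sq_truncGevrey (n : ℕ) (t : ℝ) (f : Hs s) :
    ‖truncGevrey hs hα hβ n t f‖ₑ ^ 2 = ∫⁻ ξ, (ENNReal.ofReal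
      (bracket s ξ * Real.exp (t * truncExponent α β n ξ)) * ‖hat f.toL2 ξ‖ₑ) ^ 2 := by
  rw [Hs.enorm_sq_of_hat_eq (hat_truncGevrey hs hα hβ n t f)]
  refine lintegral_congr fun ξ => ?_
  rw [enorm_mul, ← mul_assoc, ← ofReal_norm (Real.exp _ : ℂ), Complex.norm_real,
    Real.norm_of_nonneg (Real.exp_pos _).le, ← ENNReal.ofReal_mul (bracket_pos s ξ).le]

/-- By monotone convergence the Gevrey energy is the supremum of the squared norms of the truncated
multipliers, which are bounded operators on `H^s`. -/
theorem gevreyEnergy_le_iff {t : ℝ} (ht : 0 ≤ t) {f : Hs s} {M : ℝ≥0∞} :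
    gevreyEnergy α β s t f.toL2 ≤ M ↔ ∀ n, ‖truncGevrey hs hα hβ n t f‖ₑ ^ 2 ≤ M := by
  have hmeas : ∀ n : ℕ, AEMeasurable (fun ξ => (ENNReal.ofReal
      (bracket s ξ * Real.exp (t * truncExponent α β n ξ)) * ‖hat f.toL2 ξ‖ₑ) ^ 2) := by
    intro n
    have h1 : Continuous (truncExponent α β n) :=
      (continuous_gevreyExponent hα hβ).min continuous_const
    have h2 : Continuous fun ξ => bracket s ξ * Real.exp (t * truncExponent α β n ξ) :=
      (continuous_bracket s).mul (Real.continuous_exp.comp (continuous_const.mul h1))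
    exact (h2.measurable.ennreal_ofReal.aemeasurable.mul
      (aestronglyMeasurable_hat _).enorm).pow_const 2
  simp only [enorm_sq_truncGevrey]
  constructor
  · refine fun h n => le_trans (lintegral_mono fun ξ => ?_) h
    have h1 : truncExponent α β n ξ ≤ gevreyExponent α β ξ := min_le_left _ _
    have h2 := (bracket_pos s ξ).le
    unfold gevreyWeight
    gcongr
  · intro h
    refine le_of_tendsto' (lintegral_tendsto_of_tendsto_of_monotone hmeas
      (Eventually.of_forall fun ξ n m hnm => ?_) (Eventually.of_forall fun ξ => ?_)) h
    · have h1 := truncExponent_mono (α := α) (β := β) ξ hnm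
      have h2 := (bracket_pos s ξ).le
      simp only at h1 ⊢
      gcongr
    · refine tendsto_const_nhds.congr' ?_
      filter_upwards [eventually_truncExponent_eq (α := α) (β := β) ξ] with n hn
      rw [hn, gevreyWeight]

include hs hα hβ in
/-- The Gevrey energy is lower semicontinuous on `H^s`. -/
theorem isClosed_gevreyEnergy_le {t : ℝ} (ht : 0 ≤ t) (M : ℝ≥0∞) :
    IsClosed {f : Hs s | gevreyEnergy α β s t f.toL2 ≤ M} := by
  simp only [gevreyEnergy_le_iff hs hα hβ ht, Set.ofPred_forall]
  refine isClosed_iInter fun n => ?_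
  have h1 : Continuous fun f : Hs s => truncGevrey hs hα hβ n t f :=
    (continuous_truncGevrey hs hα hβ n).comp (Continuous.prodMk_right t)
  exact isClosed_le ((ENNReal.continuous_pow 2).comp h1.enorm) continuous_const

end Truncation

/-! ### The Picard map -/

/-- The linear evolution gains the Gevrey weight at the price of the factor `e^t`. -/
theorem lintegral_heat_sq_le {α β s t : ℝ} (ht : 0 ≤ t) (θ₀ : Hs s) :
    ∫⁻ ξ, (ENNReal.ofReal (gevreyWeight α β s t ξ) *
      ‖(Real.exp (-(t * dissipationSymbol α β ξ)) : ℂ) * hat θ₀.toL2 ξ‖ₑ) ^ 2 ≤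
      ENNReal.ofReal (Real.exp t) ^ 2 * ‖θ₀‖ₑ ^ 2 := by
  rw [Hs.enorm_sq, ← lintegral_const_mul' _ _ (by finiteness)]
  refine lintegral_mono fun ξ => ?_
  rw [← mul_pow]
  refine pow_le_pow_left' ?_ 2
  rw [enorm_mul, ← mul_assoc, ← mul_assoc]
  refine mul_le_mul_left ?_ _
  rw [← ofReal_norm, Complex.norm_real, Real.norm_of_nonneg (Real.exp_pos _).le,
    ← ENNReal.ofReal_mul (gevreyWeight_pos _ _ _ _ _).le, ← ENNReal.ofReal_mul (Real.exp_pos _).le]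
  refine ENNReal.ofReal_le_ofReal ?_
  rw [gevreyWeight, mul_assoc, ← Real.exp_add, mul_comm]
  have h1 := gevreyExponent_le α β ξ
  have h2 := dissipationSymbol_nonneg α β ξ
  have h3 := (bracket_pos s ξ).le
  gcongr
  nlinarith

/-- The linear evolution `t ↦ e^{-tA(D)} θ₀` is continuous in `H^s`. -/
theorem exists_heat {α β s : ℝ} (hs : 0 ≤ s) (hα : 0 ≤ α) (hβ : 0 ≤ β) (θ₀ : Hs s) :
    ∃ h : ℝ → Hs s, Continuous h ∧ ∀ t, 0 ≤ t → hat (h t).toL2 =ᵐ[volume] fun ξ =>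
      (Real.exp (-(t * dissipationSymbol α β ξ)) : ℂ) * hat θ₀.toL2 ξ := by
  have hnorm : ∀ t : ℝ, 0 ≤ t → ∀ ξ,
      ‖(Real.exp (-(t * dissipationSymbol α β ξ)) : ℂ) * hat θ₀.toL2 ξ‖ₑ ≤ ‖hat θ₀.toL2 ξ‖ₑ := by
    intro t ht ξ
    rw [enorm_mul]
    refine mul_le_of_le_one_left' ?_
    rw [← ofReal_norm, Complex.norm_real, Real.norm_of_nonneg (Real.exp_pos _).le,
      ENNReal.ofReal_le_one, Real.exp_le_one_iff]
    have := dissipationSymbol_nonneg α β ξ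
    nlinarith
  -- the multiplier is unbounded for negative times, hence the truncation `max t 0`
  have hex : ∀ t : ℝ, ∃ f : Hs s, hat f.toL2 =ᵐ[volume] fun ξ =>
      (Real.exp (-(max t 0 * dissipationSymbol α β ξ)) : ℂ) * hat θ₀.toL2 ξ := by
    intro t
    refine Hs.exists_hat_eq hs ?_ ?_
    · have h1 : Continuous fun ξ : Plane =>
          Real.exp (-(max t 0 * dissipationSymbol α β ξ)) :=
        Real.continuous_exp.comp
          (continuous_const.mul (continuous_dissipationSymbol hα hβ)).neg
      exact (Complex.continuous_ofReal.comp h1).aestronglyMeasurable.mul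
        (aestronglyMeasurable_hat _)
    · have h1 : ∫⁻ ξ, (ENNReal.ofReal (bracket s ξ) * ‖hat θ₀.toL2 ξ‖ₑ) ^ 2 < ∞ := by
        rw [← Hs.enorm_sq]; exact ENNReal.pow_lt_top enorm_lt_top
      refine lt_of_le_of_lt (lintegral_mono fun ξ => ?_) h1
      exact pow_le_pow_left' (mul_le_mul_right (hnorm _ (le_max_right _ _) ξ) _) 2
  choose h hh using hex
  refine ⟨h, continuous_iff_continuousAt.2 fun t₀ => ?_, fun t ht => ?_⟩
  · refine Hs.tendsto_of_dominated hh (hh t₀)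
      (bound := fun ξ => 2 * (ENNReal.ofReal (bracket s ξ) * ‖hat θ₀.toL2 ξ‖ₑ))
      (fun t ξ => ?_) ?_ fun ξ => ?_
    · rw [mul_left_comm]
      refine mul_le_mul_right ?_ _
      refine enorm_sub_le.trans ?_
      rw [two_mul]
      exact add_le_add (hnorm _ (le_max_right _ _) ξ) (hnorm _ (le_max_right _ _) ξ)
    · simp only [mul_pow (2 : ℝ≥0∞)]
      rw [lintegral_const_mul' _ _ (by finiteness), ← Hs.enorm_sq]
      exact ENNReal.mul_ne_top (by finiteness) (ENNReal.pow_ne_top enorm_ne_top)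
    · have hc : Continuous fun t : ℝ =>
          (Real.exp (-(max t 0 * dissipationSymbol α β ξ)) : ℂ) * hat θ₀.toL2 ξ := by fun_prop
      exact hc.tendsto t₀
  · have := hh t
    rwa [max_eq_left ht] at this

theorem continuous_kernelPrimitive {a : ℝ} (ha : a < 1) : Continuous (kernelPrimitive a) := by
  unfold kernelPrimitive
  exact (Real.continuous_rpow_const (by linarith)).div_const _

theorem gevreyEnergy_sub_zero (α β : ℝ) {s : ℝ} (f g : Hs s) :
    gevreyEnergy α β s 0 (f.toL2 - g.toL2) = ‖f - g‖ₑ ^ 2 := by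
  rw [← Hs.toL2_sub, gevreyEnergy_zero]

theorem exists_bound_on_Icc {s T : ℝ} {θ : ℝ → Hs s} (hθ : ContinuousOn θ (Icc 0 T)) :
    ∃ M : ℝ≥0∞, M ≠ ∞ ∧ ∀ τ ∈ Icc 0 T, ‖θ τ‖ₑ ^ 2 ≤ M := by
  obtain ⟨C, hC⟩ := isCompact_Icc.exists_bound_of_continuousOn hθ
  refine ⟨ENNReal.ofReal C ^ 2, by finiteness, fun τ hτ => pow_le_pow_left' ?_ 2⟩
  rw [← ofReal_norm]
  exact ENNReal.ofReal_le_ofReal (hC τ hτ)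

/-- A family with the Fourier transforms of the Duhamel term is continuous in `H^s`. -/
theorem continuousOn_of_hat_eq_duhamelTerm {α β s γ δ a : ℝ} (h : Admissible α β s γ δ a) {T : ℝ}
    {θ N : ℝ → Hs s} (hθ : Continuous θ)
    (hN : ∀ t ∈ Icc 0 T, hat (N t).toL2 =ᵐ[volume] duhamelTerm α β (fun τ => (θ τ).toL2) t) :
    ContinuousOn N (Icc 0 T) := by
  have hθ2 : Continuous fun τ => (θ τ).toL2 := (Hs.continuous_toL2 h.s_nonneg).comp hθ
  obtain ⟨M, hMt, hM⟩ := exists_bound_on_Icc (T := T) hθ.continuousOn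
  have hP := (productConst_lt_top h.one_lt).ne
  have hκ := continuous_kernelPrimitive h.a_lt_one
  have hu := isCompact_Icc.uniformContinuousOn_of_continuous (hθ.continuousOn (s := Icc 0 T))
  obtain ⟨κ, hκb⟩ := isCompact_Icc.exists_bound_of_continuousOn (hκ.continuousOn (s := Icc 0 T))
  set K₁ : ℝ≥0∞ := 2 * (ENNReal.ofReal (|smoothingConst T| * κ) ^ 2 *
    (16 * productConst s δ * M)) with hK₁
  have hK₁t : K₁ ≠ ∞ := by finiteness
  -- the two sided version of the modulus of continuity
  have key : ∀ t ∈ Icc 0 T, ∀ t' ∈ Icc 0 T, ∀ Y : ℝ≥0∞,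
      (∀ u ∈ Icc 0 T, ∀ v ∈ Icc 0 T, |u - v| = |t' - t| → ‖θ u - θ v‖ₑ ^ 2 ≤ Y) →
      ‖N t' - N t‖ₑ ^ 2 ≤ K₁ * Y + 2 * (ENNReal.ofReal (|smoothingConst T| *
        |kernelPrimitive a t' - kernelPrimitive a t|) ^ 2 * (4 * productConst s δ * M * M)) := by
    intro t ht t' ht' Y hY
    wlog htt' : t ≤ t' generalizing t t'
    · have := this t' ht' t ht (by simpa only [abs_sub_comm t t'] using hY) (le_of_not_ge htt')
      rwa [← enorm_neg (N t - N t'), neg_sub, abs_sub_comm (kernelPrimitive a t)] at this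
    have h1 := lintegral_duhamelTerm_time_sub_sq_le h ht.1 htt' ht'.2 hθ2 (M := M) (Y := Y)
      (fun τ hτ => by
        rw [gevreyEnergy_zero]
        exact hM τ ⟨hτ.1, hτ.2.trans ht'.2⟩)
      (fun τ hτ => by
        rw [gevreyEnergy_sub_zero]
        refine hY _ ⟨by linarith [hτ.1], by linarith [hτ.2, ht'.2]⟩ _ ⟨hτ.1, hτ.2.trans ht.2⟩ ?_
        congr 1; ring)
    rw [Hs.enorm_sq_eq_gevreyWeight α β (Hs.hat_sub (hN t' ht') (hN t ht))]
    refine h1.trans ?_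
    rw [mul_add, hK₁, mul_assoc 2 _ Y, mul_assoc (ENNReal.ofReal (|smoothingConst T| * κ) ^ 2)]
    gcongr 2 * (?_ * _) + 2 * (?_ * _)
    · refine pow_le_pow_left' (ENNReal.ofReal_le_ofReal ?_) 2
      refine (le_abs_self _).trans ?_
      rw [abs_mul]
      have := hκb t ht
      rw [Real.norm_eq_abs] at this
      gcongr
    · refine pow_le_pow_left' (ENNReal.ofReal_le_ofReal ?_) 2
      refine (le_abs_self _).trans ?_
      rw [abs_mul]
  intro t ht
  refine tendsto_iff_edist_tendsto_0.2 (tendsto_zero_of_sq_tendsto_zero ?_)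
  rw [ENNReal.tendsto_nhds_zero]
  intro ε hε
  have hε2 : 0 < ε / 2 := ENNReal.half_pos hε.ne'
  -- the size of the increments of `θ` that is needed
  obtain ⟨r, hr0, hr⟩ : ∃ r : ℝ, 0 < r ∧ K₁ * ENNReal.ofReal r ^ 2 ≤ ε / 2 := by
    have hc : Tendsto (fun r : ℝ => K₁ * ENNReal.ofReal r ^ 2) (𝓝[>] 0) (𝓝 0) := by
      have h1 : Tendsto (fun r : ℝ => ENNReal.ofReal r ^ 2) (𝓝 0) (𝓝 0) := by
        have := ((ENNReal.continuous_pow 2).comp ENNReal.continuous_ofReal).tendsto 0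
        simpa [Function.comp_def] using this
      have h2 := ENNReal.Tendsto.const_mul h1 (Or.inr hK₁t)
      rw [mul_zero] at h2
      exact h2.mono_left nhdsWithin_le_nhds
    obtain ⟨r, h1, h2⟩ := ((ENNReal.tendsto_nhds_zero.1 hc _ hε2).and
      self_mem_nhdsWithin).exists
    exact ⟨r, h2, h1⟩
  obtain ⟨η, hη0, hη⟩ := Metric.uniformContinuousOn_iff.1 hu r hr0
  have hlim : Tendsto (fun t' => 2 * (ENNReal.ofReal (|smoothingConst T| *
        |kernelPrimitive a t' - kernelPrimitive a t|) ^ 2 * (4 * productConst s δ * M * M)))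
      (𝓝[Icc 0 T] t) (𝓝 0) := by
    have h1 : Continuous fun t' => ENNReal.ofReal (|smoothingConst T| *
        |kernelPrimitive a t' - kernelPrimitive a t|) ^ 2 :=
      (ENNReal.continuous_pow 2).comp (ENNReal.continuous_ofReal.comp
        (continuous_const.mul (hκ.sub continuous_const).abs))
    have h2 : Tendsto (fun t' => ENNReal.ofReal (|smoothingConst T| *
        |kernelPrimitive a t' - kernelPrimitive a t|) ^ 2) (𝓝 t) (𝓝 0) := by
      have := h1.tendsto t
      simpa using this
    have h3 := ENNReal.Tendsto.const_mul (ENNReal.Tendsto.mul_const h2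
      (b := 4 * productConst s δ * M * M) (Or.inr (by finiteness))) (a := 2)
      (Or.inr (by finiteness))
    rw [zero_mul, mul_zero] at h3
    exact h3.mono_left nhdsWithin_le_nhds
  filter_upwards [ENNReal.tendsto_nhds_zero.1 hlim _ hε2, self_mem_nhdsWithin,
    mem_nhdsWithin_of_mem_nhds (Metric.ball_mem_nhds t hη0)] with t' h1 h2 h3
  rw [edist_eq_enorm_sub]
  refine (key t ht t' h2 (ENNReal.ofReal r ^ 2) fun u hu' v hv huv => ?_).trans ?_
  · refine pow_le_pow_left' ?_ 2
    rw [← edist_eq_enorm_sub, edist_dist]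
    refine ENNReal.ofReal_le_ofReal (hη u hu' v hv ?_).le
    rw [Real.dist_eq, huv, ← Real.dist_eq]
    exact h3
  · calc _ ≤ ε / 2 + ε / 2 := add_le_add hr h1
      _ = ε := ENNReal.add_halves ε

/-- The Duhamel term of a continuous path in `H^s` is a continuous path in `H^s`. -/
theorem exists_duhamel {α β s γ δ a : ℝ} (h : Admissible α β s γ δ a) (T : ℝ)
    {θ : ℝ → Hs s} (hθ : Continuous θ) :
    ∃ N : ℝ → Hs s, ContinuousOn N (Icc 0 T) ∧
      ∀ t ∈ Icc 0 T, hat (N t).toL2 =ᵐ[volume] duhamelTerm α β (fun τ => (θ τ).toL2) t := by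
  have hθ2 : Continuous fun τ => (θ τ).toL2 := (Hs.continuous_toL2 h.s_nonneg).comp hθ
  obtain ⟨M, hMt, hM⟩ := exists_bound_on_Icc (T := T) hθ.continuousOn
  have hP := (productConst_lt_top h.one_lt).ne
  have hex : ∀ t : ℝ, ∃ f : Hs s, t ∈ Icc 0 T →
      hat f.toL2 =ᵐ[volume] duhamelTerm α β (fun τ => (θ τ).toL2) t := by
    intro t
    by_cases ht : t ∈ Icc 0 T
    · have h1 := lintegral_duhamelTerm_sq_le h ht.1 ht.2 (l := 0) le_rfl zero_le_one hθ2 (M := M)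
        (fun τ hτ => by
          rw [zero_mul, gevreyEnergy_zero]
          exact hM τ ⟨hτ.1, hτ.2.trans ht.2⟩)
      obtain ⟨f, hf⟩ := Hs.exists_hat_eq h.s_nonneg
        (stronglyMeasurable_duhamelTerm h.α_nonneg h.β_nonneg hθ2 ht.1).aestronglyMeasurable <| by
          refine lt_of_le_of_lt (le_of_eq ?_) (lt_of_le_of_lt h1 (Ne.lt_top (by finiteness)))
          simp [gevreyWeight]
      exact ⟨f, fun _ => hf⟩
    · exact ⟨0, fun ht' => absurd ht' ht⟩
  choose N hN using hex
  exact ⟨N, continuousOn_of_hat_eq_duhamelTerm h hθ hN, hN⟩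

/-! ### Existence of Gevrey regular solutions -/

theorem kernelPrimitive_mono {a t t' : ℝ} (ha : a < 1) (ht : 0 ≤ t) (htt' : t ≤ t') :
    kernelPrimitive a t ≤ kernelPrimitive a t' := by
  unfold kernelPrimitive
  have h1 : 0 < 1 - a := by linarith
  have := Real.rpow_le_rpow ht htt' h1.le
  gcongr

theorem smoothingConst_nonneg {T : ℝ} (hT : 0 ≤ T) : 0 ≤ smoothingConst T := by
  unfold smoothingConst; positivity

/-- The constant in front of the Duhamel term tends to zero with the length of the time interval,
since `σ^{-a}` is integrable. -/
theorem tendsto_smoothing_zero {a : ℝ} (ha : a < 1) (T : ℝ) {K : ℝ≥0∞} (hK : K ≠ ∞) :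
    Tendsto (fun t => ENNReal.ofReal (smoothingConst T * kernelPrimitive a t) ^ 2 * K)
      (𝓝[>] 0) (𝓝 0) := by
  have h1 : Continuous fun t => ENNReal.ofReal (smoothingConst T * kernelPrimitive a t) ^ 2 :=
    (ENNReal.continuous_pow 2).comp (ENNReal.continuous_ofReal.comp
      (continuous_const.mul (continuous_kernelPrimitive ha)))
  have h2 := h1.tendsto 0
  rw [kernelPrimitive_zero ha, mul_zero, ENNReal.ofReal_zero, zero_pow two_ne_zero] at h2
  have h3 := ENNReal.Tendsto.mul_const h2 (b := K) (Or.inr hK)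
  rw [zero_mul] at h3
  exact h3.mono_left nhdsWithin_le_nhds

theorem smoothing_sq_le {a t t' T : ℝ} (ha : a < 1) (hT : 0 ≤ T) (ht : 0 ≤ t) (htt' : t ≤ t') :
    ENNReal.ofReal (smoothingConst T * kernelPrimitive a t) ^ 2 ≤
      ENNReal.ofReal (smoothingConst T * kernelPrimitive a t') ^ 2 := by
  have h1 := kernelPrimitive_mono ha ht htt'
  have h2 := smoothingConst_nonneg hT
  gcongr

/-- The Gevrey energy of a mild candidate `e^{-tA(D)} θ₀ - N`. -/
theorem gevreyEnergy_picard_le {α β s γ δ a : ℝ} (h : Admissible α β s γ δ a) {t T : ℝ}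
    (ht : 0 ≤ t) (htT : t ≤ T) {θ₀ : Hs s} {θ : ℝ → L2} (hθ : Continuous θ) {M : ℝ≥0∞}
    (hM : ∀ τ ∈ Icc 0 t, gevreyEnergy α β s τ (θ τ) ≤ M) {f : Hs s}
    (hf : hat f.toL2 =ᵐ[volume] fun ξ =>
      (Real.exp (-(t * dissipationSymbol α β ξ)) : ℂ) * hat θ₀.toL2 ξ - duhamelTerm α β θ t ξ) :
    gevreyEnergy α β s t f.toL2 ≤ 2 * (ENNReal.ofReal (Real.exp t) ^ 2 * ‖θ₀‖ₑ ^ 2 +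
      ENNReal.ofReal (smoothingConst T * kernelPrimitive a t) ^ 2 *
        (4 * productConst s δ * M * M)) := by
  have hWm : Measurable fun ξ => ENNReal.ofReal (gevreyWeight α β s t ξ) :=
    (measurable_gevreyWeight h.α_nonneg h.β_nonneg s t).ennreal_ofReal
  have hlin : AEStronglyMeasurable (fun ξ =>
      (Real.exp (-(t * dissipationSymbol α β ξ)) : ℂ) * hat θ₀.toL2 ξ) volume := by
    have h1 : Continuous fun ξ : Plane => Real.exp (-(t * dissipationSymbol α β ξ)) :=
      Real.continuous_exp.comp
        (continuous_const.mul (continuous_dissipationSymbol h.α_nonneg h.β_nonneg)).neg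
    exact (Complex.continuous_ofReal.comp h1).aestronglyMeasurable.mul (aestronglyMeasurable_hat _)
  have h1 := lintegral_heat_sq_le (α := α) (β := β) ht θ₀
  have h2 := lintegral_duhamelTerm_sq_le h ht htT (l := 1) zero_le_one le_rfl hθ (M := M)
    (by simpa only [one_mul] using hM)
  rw [one_mul] at h2
  refine le_trans ?_ (mul_le_mul_right (add_le_add h1 h2) 2)
  refine le_trans (lintegral_mono_ae (hf.mono fun ξ hξ => ?_))
    (lintegral_add_sq_le (hWm.aemeasurable.mul hlin.enorm))
  rw [hξ]
  refine pow_le_pow_left' ?_ 2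
  refine le_trans ?_ (mul_add _ _ _).le
  exact mul_le_mul_right enorm_sub_le _

/-- The Picard map contracts the set of continuous paths with Gevrey energy at most `(2‖θ₀‖)²` at
all times. This set is closed in `C([0,T], H^s)`, although the Gevrey energy is not continuous
there. -/
theorem exists_gevrey_solution {α β s γ δ a : ℝ} (h : Admissible α β s γ δ a) (θ₀ : Hs s) :
    ∃ T : ℝ, 0 < T ∧ ∃ θ : ℝ → Hs s, IsMildSolution α β θ₀ T θ ∧
      ∀ t ∈ Icc 0 T, gevreyEnergy α β s t (θ t).toL2 ≤ (2 * ‖θ₀‖ₑ) ^ 2 := by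
  have hP := (productConst_lt_top h.one_lt).ne
  set P := productConst s δ
  set m : ℝ≥0∞ := ‖θ₀‖ₑ ^ 2 with hm
  have hmt : m ≠ ∞ := by rw [hm]; finiteness
  have hR : (2 * ‖θ₀‖ₑ) ^ 2 = 4 * m := by rw [mul_pow, hm]; norm_num
  rw [hR]
  -- With `K` the factor in front of the Duhamel term: the energy bound needs
  -- `2 (3/2 m + K · 4P · (4m)²) ≤ 4m`, and the contraction needs `K · 16P · 4m ≤ 1/4`.
  obtain ⟨T, hT0, hT1, hTexp, hTsmall⟩ : ∃ T : ℝ, 0 < T ∧ T ≤ 1 ∧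
      ENNReal.ofReal (Real.exp T) ^ 2 ≤ 3 / 2 ∧
      ENNReal.ofReal (smoothingConst 1 * kernelPrimitive a T) ^ 2 * (64 * P * m) ≤ 1 / 4 := by
    have e1 : ∀ᶠ T : ℝ in 𝓝[>] 0, T ≤ 1 :=
      mem_nhdsWithin_of_mem_nhds (Iic_mem_nhds zero_lt_one)
    have e2 : ∀ᶠ T : ℝ in 𝓝[>] 0, ENNReal.ofReal (Real.exp T) ^ 2 ≤ 3 / 2 := by
      have hc : Continuous fun T : ℝ => ENNReal.ofReal (Real.exp T) ^ 2 :=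
        (ENNReal.continuous_pow 2).comp (ENNReal.continuous_ofReal.comp Real.continuous_exp)
      have h1 := hc.tendsto 0
      rw [Real.exp_zero, ENNReal.ofReal_one, one_pow] at h1
      have h2 : (1 : ℝ≥0∞) < 3 / 2 := by
        rw [ENNReal.lt_div_iff_mul_lt (by norm_num) (by norm_num)]; norm_num
      exact nhdsWithin_le_nhds (h1.eventually (Iic_mem_nhds h2))
    have e3 := (tendsto_smoothing_zero h.a_lt_one 1 (K := 64 * P * m) (by finiteness)).eventually
      (Iic_mem_nhds (show (0 : ℝ≥0∞) < 1 / 4 by simp))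
    obtain ⟨T, ⟨⟨h1, h2⟩, h3⟩, h4⟩ := (((e1.and e2).and e3).and self_mem_nhdsWithin).exists
    exact ⟨T, h4, h1, h2, h3⟩
  refine ⟨T, hT0, ?_⟩
  have := Hs.completeSpace h.s_nonneg
  obtain ⟨H, hHc, hH⟩ := exists_heat h.s_nonneg h.α_nonneg h.β_nonneg θ₀
  have hext : ∀ f : C(Icc 0 T, Hs s), Continuous (IccExtend hT0.le f) :=
    fun f => f.continuous.Icc_extend'
  choose N hNc hN using fun f : C(Icc 0 T, Hs s) => exists_duhamel h T (hext f)
  let Φ : C(Icc 0 T, Hs s) → C(Icc 0 T, Hs s) := fun f =>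
    ⟨fun t => H t - N f t, (hHc.comp continuous_subtype_val).sub
      (continuousOn_iff_continuous_domRestrict.1 (hNc f))⟩
  have hΦ : ∀ f (t : Icc 0 T), hat (Φ f t).toL2 =ᵐ[volume] fun ξ =>
      (Real.exp (-(t * dissipationSymbol α β ξ)) : ℂ) * hat θ₀.toL2 ξ -
        duhamelTerm α β (fun τ => (IccExtend hT0.le f τ).toL2) t ξ :=
    fun f t => Hs.hat_sub (hH t t.2.1) (hN f t t.2)
  -- the energy at time `t` is weighted with the Gevrey weight of parameter `t`
  let S : Set C(Icc 0 T, Hs s) := {f | ∀ t : Icc 0 T, gevreyEnergy α β s t (f t).toL2 ≤ 4 * m}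
  have hSc : IsClosed S := by
    have : S = ⋂ t : Icc 0 T, (fun f : C(Icc 0 T, Hs s) => f t) ⁻¹'
        {f : Hs s | gevreyEnergy α β s t f.toL2 ≤ 4 * m} := by
      ext f
      simp [S]
    rw [this]
    exact isClosed_iInter fun t =>
      (isClosed_gevreyEnergy_le h.s_nonneg h.α_nonneg h.β_nonneg t.2.1 _).preimage
        (continuous_eval_const t)
  have hSext : ∀ f ∈ S, ∀ τ ∈ Icc 0 T,
      gevreyEnergy α β s τ (IccExtend hT0.le f τ).toL2 ≤ 4 * m := by
    intro f hf τ hτ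
    rw [IccExtend_of_mem hT0.le _ hτ]
    exact hf ⟨τ, hτ⟩
  have hΦS : MapsTo Φ S S := by
    intro f hf t
    refine (gevreyEnergy_picard_le h t.2.1 (t.2.2.trans hT1)
      ((Hs.continuous_toL2 h.s_nonneg).comp (hext f)) (M := 4 * m)
      (fun τ hτ => hSext f hf τ ⟨hτ.1, hτ.2.trans t.2.2⟩) (hΦ f t)).trans ?_
    have h1 : ENNReal.ofReal (Real.exp t) ^ 2 ≤ 3 / 2 := by
      refine le_trans ?_ hTexp
      have := t.2.2
      gcongr
    have h2 : ENNReal.ofReal (smoothingConst 1 * kernelPrimitive a t) ^ 2 *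
        (4 * P * (4 * m) * (4 * m)) ≤ 1 / 4 * m := by
      refine le_trans ?_ (mul_le_mul_left hTsmall m)
      have := smoothing_sq_le h.a_lt_one zero_le_one t.2.1 t.2.2
      calc _ ≤ ENNReal.ofReal (smoothingConst 1 * kernelPrimitive a T) ^ 2 *
            (4 * P * (4 * m) * (4 * m)) := by gcongr
        _ = _ := by ring
    calc _ ≤ 2 * (3 / 2 * m + 1 / 4 * m) := by gcongr
      _ ≤ 2 * (2 * m) := by
        rw [← add_mul]
        gcongr
        rw [← ENNReal.toReal_le_toReal (by finiteness) (by finiteness),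
          ENNReal.toReal_add (by finiteness) (by finiteness)]
        norm_num
      _ = 4 * m := by rw [← mul_assoc]; norm_num
  have hcontr : ContractingWith (1 / 2) (hΦS.restrict Φ S S) := by
    refine ⟨by rw [← NNReal.coe_lt_coe]; norm_num, LipschitzWith.of_dist_le_mul fun f g => ?_⟩
    rw [Subtype.dist_eq, Subtype.dist_eq]
    obtain ⟨f, hf⟩ := f
    obtain ⟨g, hg⟩ := g
    simp only [MapsTo.val_restrict_apply]
    rw [ContinuousMap.dist_le (by positivity)]
    intro t
    have hdist : ∀ τ, ‖IccExtend hT0.le f τ - IccExtend hT0.le g τ‖ₑ ^ 2 ≤ edist f g ^ 2 := by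
      intro τ
      refine pow_le_pow_left' ?_ 2
      rw [← edist_eq_enorm_sub, edist_dist, edist_dist]
      exact ENNReal.ofReal_le_ofReal (ContinuousMap.dist_apply_le_dist _)
    have hzero : ∀ f ∈ S, ∀ τ ∈ Icc 0 (t : ℝ),
        gevreyEnergy α β s 0 (IccExtend hT0.le f τ).toL2 ≤ 4 * m := fun f hf τ hτ =>
      (gevreyEnergy_mono hτ.1 _).trans (hSext f hf τ ⟨hτ.1, hτ.2.trans t.2.2⟩)
    have h1 := lintegral_duhamelTerm_sub_sq_le h t.2.1 le_rfl (t.2.2.trans hT1)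
      ((Hs.continuous_toL2 h.s_nonneg).comp (hext g))
      ((Hs.continuous_toL2 h.s_nonneg).comp (hext f)) (M := 4 * m) (Y := edist f g ^ 2)
      (hzero g hg) (hzero f hf)
      (fun τ _ => by
        simp only [Function.comp_apply]
        rw [gevreyEnergy_sub_zero, edist_comm]
        have := hdist τ
        rwa [← enorm_neg, neg_sub, edist_comm] at this)
      (fun τ h0 h1 => by linarith)
    have h2 : ‖Φ f t - Φ g t‖ₑ ^ 2 ≤ 1 / 4 * edist f g ^ 2 := by
      have h3 : Φ f t - Φ g t = N g t - N f t := by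
        simp only [Φ, ContinuousMap.coe_mk]; abel
      rw [h3, Hs.enorm_sq_eq_gevreyWeight α β (Hs.hat_sub (hN g t t.2) (hN f t t.2))]
      refine h1.trans ((le_trans ?_ (mul_le_mul_left hTsmall (edist f g ^ 2))))
      have := smoothing_sq_le h.a_lt_one zero_le_one t.2.1 t.2.2
      calc _ ≤ ENNReal.ofReal (smoothingConst 1 * kernelPrimitive a T) ^ 2 *
            (16 * P * (4 * m) * edist f g ^ 2) := by gcongr
        _ = _ := by ring
    have h4 : ‖Φ f t - Φ g t‖ₑ ≤ 1 / 2 * edist f g := by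
      refine (ENNReal.pow_le_pow_left_iff two_ne_zero).1 (h2.trans (le_of_eq ?_))
      rw [mul_pow, one_div, one_div, ← ENNReal.inv_pow]
      norm_num
    rw [← edist_eq_enorm_sub, edist_dist, edist_dist,
      show (1 / 2 : ℝ≥0∞) = ENNReal.ofReal (1 / 2) by
        rw [ENNReal.ofReal_div_of_pos two_pos]; simp,
      ← ENNReal.ofReal_mul (by norm_num), ENNReal.ofReal_le_ofReal_iff (by positivity)] at h4
    simpa using h4
  obtain ⟨θ, hθS, hθfix, -⟩ := hcontr.exists_fixedPoint' hSc.isComplete hΦS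
    (x := Φ (ContinuousMap.const _ 0)) (hΦS fun t => by
      have h1 : gevreyEnergy α β s t (0 : L2) = 0 := by
        rw [gevreyEnergy, lintegral_eq_zero_of_ae_eq_zero]
        filter_upwards [hat_zero] with ξ hξ
        simp [hξ]
      simp only [ContinuousMap.const_apply, Hs.toL2_zero, h1]
      exact zero_le) (edist_ne_top _ _)
  refine ⟨IccExtend hT0.le θ, ⟨(hext θ).continuousOn, fun t ht => ?_⟩, hSext θ hθS⟩
  have h1 := hΦ θ ⟨t, ht⟩
  rw [hθfix] at h1
  rw [IccExtend_of_mem hT0.le _ ht]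
  exact h1

/-! ### Uniqueness -/

theorem IsMildSolution.congr {α β s : ℝ} {θ₀ : Hs s} {T : ℝ} {θ θ' : ℝ → Hs s}
    (h : IsMildSolution α β θ₀ T θ) (he : EqOn θ' θ (Icc 0 T)) : IsMildSolution α β θ₀ T θ' := by
  refine ⟨h.continuousOn.congr he, fun t ht => ?_⟩
  have h1 : ∀ ξ, duhamelTerm α β (fun τ => (θ' τ).toL2) t ξ =
      duhamelTerm α β (fun τ => (θ τ).toL2) t ξ := duhamelTerm_congr α β ht.1 fun τ hτ => by
    simp only [he ⟨hτ.1, hτ.2.trans ht.2⟩]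
  filter_upwards [h.duhamel t ht] with ξ hξ
  rw [he ht, hξ]
  exact congrArg _ (h1 ξ).symm

theorem IsMildSolution.mono {α β s : ℝ} {θ₀ : Hs s} {T T' : ℝ} {θ : ℝ → Hs s}
    (h : IsMildSolution α β θ₀ T θ) (hT : T' ≤ T) : IsMildSolution α β θ₀ T' θ :=
  ⟨h.continuousOn.mono (Icc_subset_Icc_right hT), fun t ht => h.duhamel t ⟨ht.1, ht.2.trans hT⟩⟩

/-- A path which is continuous on `[0, T]` extends to a globally continuous path. -/
theorem exists_continuous_eqOn {s T : ℝ} (hT : 0 ≤ T) {θ : ℝ → Hs s}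
    (hθ : ContinuousOn θ (Icc 0 T)) : ∃ θ' : ℝ → Hs s, Continuous θ' ∧ EqOn θ' θ (Icc 0 T) := by
  refine ⟨IccExtend hT fun t : Icc 0 T => θ t, ?_, fun t ht => ?_⟩
  · exact (continuousOn_iff_continuous_domRestrict.1 hθ).Icc_extend'
  · rw [IccExtend_of_mem hT _ ht]

/-- Two solutions agree on `[0, nε)` for every `n`: on each further step of length `ε` the squared
norm of the difference of the Duhamel terms is at most half of the largest squared distance of the
solutions. -/
theorem eqOn_of_continuous {α β s γ δ a : ℝ} (h : Admissible α β s γ δ a) {θ₀ : Hs s} {T : ℝ}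
    (hT : 0 ≤ T) {θ θ' : ℝ → Hs s} (hc : Continuous θ) (hc' : Continuous θ')
    (hθ : IsMildSolution α β θ₀ T θ) (hθ' : IsMildSolution α β θ₀ T θ') :
    EqOn θ θ' (Icc 0 T) := by
  have hP := (productConst_lt_top h.one_lt).ne
  obtain ⟨M₁, hM₁t, hM₁⟩ := exists_bound_on_Icc (T := T) hc.continuousOn
  obtain ⟨M₂, hM₂t, hM₂⟩ := exists_bound_on_Icc (T := T) hc'.continuousOn
  set M := M₁ + M₂ with hMdef
  have hM : M ≠ ∞ := by finiteness
  -- a time step on which the difference of the Duhamel terms contracts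
  obtain ⟨ε, hε0, hε⟩ : ∃ ε : ℝ, 0 < ε ∧ ENNReal.ofReal (smoothingConst T *
      kernelPrimitive a ε) ^ 2 * (16 * productConst s δ * M) ≤ 1 / 2 := by
    have e := (tendsto_smoothing_zero h.a_lt_one T (K := 16 * productConst s δ * M)
      (by finiteness)).eventually (Iic_mem_nhds (show (0 : ℝ≥0∞) < 1 / 2 by simp))
    obtain ⟨ε, h1, h2⟩ := (e.and self_mem_nhdsWithin).exists
    exact ⟨ε, h2, h1⟩
  have hstep : ∀ n : ℕ, ∀ t ∈ Icc 0 T, t < n * ε → θ t = θ' t := by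
    intro n
    induction n with
    | zero =>
      intro t ht h1
      simp only [Nat.cast_zero, zero_mul] at h1
      exact absurd ht.1 (not_le.2 h1)
    | succ n ih =>
      set I : Set ℝ := {t | t ∈ Icc 0 T ∧ t < (n + 1 : ℕ) * ε} with hI
      set Y : ℝ≥0∞ := ⨆ t ∈ I, ‖θ t - θ' t‖ₑ ^ 2 with hY
      have hYle : ∀ t ∈ I, ‖θ t - θ' t‖ₑ ^ 2 ≤ Y := fun t ht =>
        le_iSup₂ (f := fun t _ => ‖θ t - θ' t‖ₑ ^ 2) t ht
      have hYt : Y ≠ ∞ := by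
        have h1 : Y ≤ 2 * M := iSup₂_le fun t ht => by
          refine (pow_le_pow_left' enorm_sub_le 2).trans ((add_sq_le_two_mul _ _).trans ?_)
          exact mul_le_mul_right (add_le_add (hM₁ t ht.1) (hM₂ t ht.1)) 2
        exact ne_top_of_le_ne_top (by finiteness) h1
      have hhalf : Y ≤ 1 / 2 * Y := by
        refine iSup₂_le fun t ht => ?_
        -- on `[0, nε)` the difference vanishes; beyond, only the last step contributes
        rcases lt_or_ge t (n * ε) with htn | htn
        · rw [ih t ht.1 htn, sub_self, enorm_zero, zero_pow two_ne_zero]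
          exact zero_le
        have hn0 : 0 ≤ n * ε := by positivity
        have hb : t - n * ε ≤ ε := by
          have := ht.2
          push_cast at this
          linarith
        have hlt := lintegral_duhamelTerm_sub_sq_le h (t := t) (b := t - n * ε) (T := T)
          (by linarith) (by linarith) ht.1.2 ((Hs.continuous_toL2 h.s_nonneg).comp hc')
          ((Hs.continuous_toL2 h.s_nonneg).comp hc) (M := M) (Y := Y)
          (fun τ hτ => by
            simp only [Function.comp_apply, gevreyEnergy_zero]
            exact (hM₂ τ ⟨hτ.1, hτ.2.trans ht.1.2⟩).trans le_add_self)
          (fun τ hτ => by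
            simp only [Function.comp_apply, gevreyEnergy_zero]
            exact (hM₁ τ ⟨hτ.1, hτ.2.trans ht.1.2⟩).trans le_self_add)
          (fun τ hτ => by
            simp only [Function.comp_apply, gevreyEnergy_sub_zero]
            rw [← enorm_neg, neg_sub]
            exact hYle τ ⟨⟨hτ.1, hτ.2.trans ht.1.2⟩, hτ.2.trans_lt ht.2⟩)
          (fun τ h0 h1 => by
            simp only [Function.comp_apply]
            rw [ih τ ⟨h0, by linarith [ht.1.2]⟩ (by linarith)])
        have hdiff : hat (θ t - θ' t).toL2 =ᵐ[volume] fun ξ =>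
            duhamelTerm α β (fun τ => (θ' τ).toL2) t ξ -
              duhamelTerm α β (fun τ => (θ τ).toL2) t ξ := by
          filter_upwards [Hs.hat_sub (hθ.duhamel t ht.1) (hθ'.duhamel t ht.1)] with ξ hξ
          rw [hξ, sub_sub_sub_cancel_left]
          rfl
        rw [Hs.enorm_sq_eq_gevreyWeight α β hdiff]
        refine hlt.trans ?_
        have := smoothing_sq_le h.a_lt_one hT (t := t - n * ε) (by linarith) hb
        calc _ ≤ ENNReal.ofReal (smoothingConst T * kernelPrimitive a ε) ^ 2 *
              (16 * productConst s δ * M * Y) := by gcongr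
          _ = (ENNReal.ofReal (smoothingConst T * kernelPrimitive a ε) ^ 2 *
              (16 * productConst s δ * M)) * Y := by ring
          _ ≤ 1 / 2 * Y := mul_le_mul_left hε Y
      have hY0 : Y = 0 := by
        by_contra hne
        refine absurd hhalf (not_le.2 ?_)
        rw [one_div, mul_comm, ← div_eq_mul_inv]
        exact ENNReal.half_lt_self hne hYt
      intro t ht htn
      have h1 := hYle t ⟨ht, htn⟩
      rw [hY0, nonpos_iff_eq_zero, pow_eq_zero_iff two_ne_zero, enorm_eq_zero, sub_eq_zero] at h1
      exact h1
  intro t ht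
  obtain ⟨n, hn⟩ := exists_nat_gt (t / ε)
  exact hstep n t ht ((div_lt_iff₀ hε0).1 hn)

theorem IsMildSolution.eqOn {α β s γ δ a : ℝ} (h : Admissible α β s γ δ a) {θ₀ : Hs s} {T : ℝ}
    {θ θ' : ℝ → Hs s} (hθ : IsMildSolution α β θ₀ T θ) (hθ' : IsMildSolution α β θ₀ T θ') :
    EqOn θ θ' (Icc 0 T) := by
  rcases lt_or_ge T 0 with hT | hT
  · rw [Icc_eq_empty (not_le.2 hT)]
    exact eqOn_empty _ _
  obtain ⟨u, hu, hue⟩ := exists_continuous_eqOn hT hθ.continuousOn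
  obtain ⟨v, hv, hve⟩ := exists_continuous_eqOn hT hθ'.continuousOn
  exact hue.symm.trans ((eqOn_of_continuous h hT hu hv (hθ.congr hue) (hθ'.congr hve)).trans hve)

/-! ### Gevrey regularity -/

/-- The pointwise energy bound is the boundedness in `H^s`. The measurability of the path
`t ↦ e^{t(|∂₁|^α + |∂₂|^β)} θ(t)` comes from the truncated multipliers, for which it is continuous. -/
theorem hasGevreyRegularity_of_energy_le {α β s : ℝ} (hs : 0 ≤ s) (hα : 0 ≤ α) (hβ : 0 ≤ β)
    {T : ℝ} (hT : 0 ≤ T) {θ : ℝ → Hs s} (hθ : ContinuousOn θ (Icc 0 T)) {M : ℝ≥0∞} (hM : M ≠ ∞)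
    (hE : ∀ t ∈ Icc 0 T, gevreyEnergy α β s t (θ t).toL2 ≤ M ^ 2) :
    HasGevreyRegularity α β T θ := by
  have hfin : ∀ t ∈ Icc 0 T, gevreyEnergy α β s t (θ t).toL2 < ∞ := fun t ht =>
    (hE t ht).trans_lt (by finiteness)
  have henorm : ∀ t ξ, ENNReal.ofReal (bracket s ξ) * ‖gevreySymbol α β t ξ * hat (θ t).toL2 ξ‖ₑ =
      ENNReal.ofReal (gevreyWeight α β s t ξ) * ‖hat (θ t).toL2 ξ‖ₑ := by
    intro t ξ
    rw [enorm_mul, ← mul_assoc, gevreySymbol, ← ofReal_norm (Real.exp _ : ℂ), Complex.norm_real,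
      Real.norm_of_nonneg (Real.exp_pos _).le, ← ENNReal.ofReal_mul (bracket_pos s ξ).le]
    rfl
  have hex : ∀ t : ℝ, ∃ f : Hs s, t ∈ Icc 0 T →
      hat f.toL2 =ᵐ[volume] fun ξ => gevreySymbol α β t ξ * hat (θ t).toL2 ξ := by
    intro t
    by_cases ht : t ∈ Icc 0 T
    · obtain ⟨f, hf⟩ := Hs.exists_hat_eq (s := s) hs
        (F := fun ξ => gevreySymbol α β t ξ * hat (θ t).toL2 ξ) (by
          refine AEStronglyMeasurable.mul ?_ (aestronglyMeasurable_hat _)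
          have h1 : Continuous fun ξ => Real.exp (t * gevreyExponent α β ξ) :=
            Real.continuous_exp.comp (continuous_const.mul (continuous_gevreyExponent hα hβ))
          exact (Complex.continuous_ofReal.comp h1).aestronglyMeasurable) (by
          simp only [henorm]
          exact hfin t ht)
      exact ⟨f, fun _ => hf⟩
    · exact ⟨0, fun ht' => absurd ht' ht⟩
  choose Θ hΘ using hex
  obtain ⟨u, hu, hue⟩ := exists_continuous_eqOn hT hθ
  -- `Θ` is a pointwise limit of continuous paths
  have hlim : ∀ t ∈ Icc 0 T,
      Tendsto (fun n => truncGevrey hs hα hβ n t (u t)) atTop (𝓝 (Θ t)) := by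
    intro t ht
    rw [hue ht]
    refine Hs.tendsto_of_dominated (fun n => hat_truncGevrey hs hα hβ n t (θ t)) (hΘ t ht)
      (bound := fun ξ => ENNReal.ofReal (gevreyWeight α β s t ξ) * ‖hat (θ t).toL2 ξ‖ₑ)
      (fun n ξ => ?_) (hfin t ht).ne fun ξ => ?_
    · rw [← henorm, ← sub_mul, enorm_mul, enorm_mul]
      gcongr
      rw [gevreySymbol, ← Complex.ofReal_sub, ← ofReal_norm, ← ofReal_norm, Complex.norm_real,
        Complex.norm_real]
      refine ENNReal.ofReal_le_ofReal ?_
      have h1 : truncExponent α β n ξ ≤ |ξ 0| ^ α + |ξ 1| ^ β := min_le_left _ _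
      have h2 := Real.exp_le_exp.2 (mul_le_mul_of_nonneg_left h1 ht.1)
      have h3 := Real.exp_pos (t * truncExponent α β n ξ)
      rw [Real.norm_eq_abs, Real.norm_of_nonneg (Real.exp_pos _).le, abs_le]
      constructor <;> linarith
    · refine tendsto_const_nhds.congr' ?_
      filter_upwards [eventually_truncExponent_eq (α := α) (β := β) ξ] with n hn
      rw [hn]
      rfl
  refine ⟨Θ, hΘ, memLp_top_of_bound (C := M.toReal) ?_ ?_⟩
  · refine aestronglyMeasurable_of_tendsto_ae atTop
      (f := fun (n : ℕ) t => truncGevrey hs hα hβ n t (u t)) (fun n => ?_)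
      ((ae_restrict_iff' measurableSet_Icc).2 (Eventually.of_forall hlim))
    have h1 : Continuous fun t => truncGevrey hs hα hβ n t (u t) :=
      (continuous_truncGevrey hs hα hβ n).comp (continuous_id.prodMk hu)
    exact h1.aestronglyMeasurable
  · refine (ae_restrict_iff' measurableSet_Icc).2 (Eventually.of_forall fun t ht => ?_)
    have h1 : ‖Θ t‖ₑ ^ 2 ≤ M ^ 2 := by
      rw [Hs.enorm_sq_of_hat_eq (hΘ t ht)]
      simp only [henorm]
      exact hE t ht
    have h2 := (ENNReal.pow_le_pow_left_iff two_ne_zero).1 h1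
    rw [← toReal_enorm]
    exact ENNReal.toReal_mono hM h2

/-- The range `max {2 - 2α, 2 - 2β} < s` leaves room for the loss of derivatives. With
`γ = min α β`, the exponent `a = (1 + δ) / (2γ)` is less than one for `δ < 2γ - 1`, while the
product law needs `δ > 1 - s`; as `γ > 1/2`, such a `δ ≥ 0` exists when `s > 2 - 2γ`. -/
theorem exists_admissible {α β s : ℝ} (hα : 1 / 2 < α ∧ α < 1) (hβ : 1 / 2 < β ∧ β < 1)
    (hs : max (2 - 2 * α) (2 - 2 * β) < s) : ∃ γ δ a : ℝ, Admissible α β s γ δ a := by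
  obtain ⟨hs1, hs2⟩ := max_lt_iff.1 hs
  obtain ⟨γ, hγα, hγβ, hγ, hγs⟩ : ∃ γ, γ ≤ α ∧ γ ≤ β ∧ 1 / 2 < γ ∧ 2 - 2 * γ < s := by
    rcases le_total α β with hab | hab
    · exact ⟨α, le_rfl, hab, hα.1, hs1⟩
    · exact ⟨β, hab, le_rfl, hβ.1, hs2⟩
  obtain ⟨δ, hδ, hδγ⟩ := exists_between (a₁ := max 0 (1 - s)) (a₂ := 2 * γ - 1)
    (max_lt (by linarith) (by linarith))
  obtain ⟨hδ0, hδ1⟩ := max_lt_iff.1 hδ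
  refine ⟨γ, δ, (1 + δ) / (2 * γ), by linarith, hγα, hγβ, hα.2.le, hβ.2.le, by linarith [hα.2],
    hδ0.le, by linarith, by positivity, ?_, by field_simp⟩
  rw [div_lt_one (by linarith)]
  linarith

end AQG

end

theorem proposition4p1 (α β s : ℝ) (hα : 1 / 2 < α ∧ α < 1) (hβ : 1 / 2 < β ∧ β < 1)
    (hs : max (2 - 2 * α) (2 - 2 * β) < s ∧ s < 2) (θ₀ : AQG.Hs s) :
    (∃ T₀ : ℝ, 0 < T₀ ∧ ∃ θ : ℝ → AQG.Hs s, AQG.IsMildSolution α β θ₀ T₀ θ ∧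
      ∀ t ∈ Set.Icc 0 T₀, ‖θ t‖ ≤ 2 * ‖θ₀‖) ∧
    ∀ T₀ : ℝ, 0 < T₀ → ∀ θ : ℝ → AQG.Hs s, AQG.IsMildSolution α β θ₀ T₀ θ →
      (∀ θ' : ℝ → AQG.Hs s, AQG.IsMildSolution α β θ₀ T₀ θ' → Set.EqOn θ θ' (Set.Icc 0 T₀)) ∧
      ∃ T₁ : ℝ, 0 < T₁ ∧ T₁ ≤ T₀ ∧ AQG.HasGevreyRegularity α β T₁ θ := by
  obtain ⟨γ, δ, a, h⟩ := AQG.exists_admissible hα hβ hs.1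
  obtain ⟨T, hT0, θG, hθG, hE⟩ := AQG.exists_gevrey_solution h θ₀
  refine ⟨⟨T, hT0, θG, hθG, fun t ht => ?_⟩, fun T₀ hT₀ θ hθ => ⟨fun θ' hθ' => hθ.eqOn h hθ', ?_⟩⟩
  · have h1 := (AQG.gevreyEnergy_mono ht.1 _).trans (hE t ht)
    rw [AQG.gevreyEnergy_zero] at h1
    have h2 := (ENNReal.pow_le_pow_left_iff two_ne_zero).1 h1
    have h3 := ENNReal.toReal_mono (by finiteness) h2
    simpa using h3
  · have hm : 0 < min T T₀ := lt_min hT0 hT₀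
    have heq := (hθ.mono (min_le_right T T₀)).eqOn h (hθG.mono (min_le_left T T₀))
    refine ⟨min T T₀, hm, min_le_right _ _, ?_⟩
    refine AQG.hasGevreyRegularity_of_energy_le h.s_nonneg h.α_nonneg h.β_nonneg hm.le
      (hθ.mono (min_le_right T T₀)).continuousOn (M := 2 * ‖θ₀‖ₑ) (by finiteness) fun t ht => ?_
    rw [heq ht]
    exact hE t ⟨ht.1, ht.2.trans (min_le_left _ _)⟩
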